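/- For a real number $y$ let $\Vert y\Vert := \min_{n\in\mathbb Z}|y-n|$. For an integer $j\ge 0$ with binary expansion $j=\sum_q e_q(j)2^q$, $e_q(j)\in\{0,1\}$, and a sequence $\lambda=(\lambda_q)_{q\ge 0}$ of real numbers, let $u(j,\lambda):=\sum_q e_q(j)\lambda_q$. A sequence $(v_j)_{j\ge0}$ of real numbers is uniformly distributed modulo $1$ if for all $0\le a<b\le 1$ the proportion of $j<N$ such that the fractional part of $v_j$ lies in $[a,b)$ tends to $b-a$ as $N\to\infty$. A set of real numbers is dense modulo $1$ if its image in $\mathbb R/\mathbb Z$ is dense. A Pisot number is a real algebraic integer $\theta>1$ all of whose other complex conjugates $z$ satisfy $|z|<1$. (1) For every sequence $\lambda=(\lambda_q)_{q\ge 0}$ of real numbers, the sequence $j\mapsto u(j,\lambda)$ is uniformly distributed modulo $1$ if and only if for each integer $\ell\ge 1$ either $\sum_{q\ge 0}\Vert \ell\lambda_q\Vert^2=+\infty$ or there exists $q\ge 0$ (depending on $\ell$) such that $\ell\lambda_q\equiv\frac12 \bmod 1$. (2) Let $\theta>1$ and $x$ be real numbers. The sequence $\bigl(x\sum_q e_q(k)\theta^q\bigr)_{k\ge0}$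 is uniformly distributed modulo $1$ if and only if either $\theta$ is not a Pisot number and $x\ne 0$, or $\theta$ is a Pisot number and $x\notin\mathbb Q(\theta)$. (3) Let $\theta>1$ and $x$ be real numbers. If $\theta$ is not a Pisot number and $x\neq 0$, or if $\theta$ is a Pisot number and $x\notin\mathbb Q(\theta)$, then the set of finite sums $x\sum_{n\in S}\theta^{n}$, where $S$ runs over the finite sets of nonnegative integers, is dense modulo $1$. -/

import Mathlib

/-- The binary digit `e_q(j)`, so that `j = ∑ q, e_q(j) * 2 ^ q`. -/
def binDigit (q j : ℕ) : ℕ := j / 2 ^ q % 2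

theorem binDigit_eq_zero_or_one (q j : ℕ) : binDigit q j = 0 ∨ binDigit q j = 1 :=
  Nat.mod_two_eq_zero_or_one _

/-- Only the positions below `Nat.size j` carry a nonzero digit of `j`. -/
theorem binDigit_eq_zero_of_size_le {q j : ℕ} (h : j.size ≤ q) : binDigit q j = 0 := by
  unfold binDigit
  rw [Nat.div_eq_of_lt (Nat.size_le.mp h)]

theorem sum_binDigit_mul_two_pow (j : ℕ) :
    ∑ q ∈ Finset.range j.size, binDigit q j * 2 ^ q = j := by
  have key : ∀ n : ℕ, ∑ q ∈ Finset.range n, binDigit q j * 2 ^ q = j % 2 ^ n := by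
    intro n
    induction n with
    | zero => simp [Nat.mod_one]
    | succ n ih =>
      rw [Finset.sum_range_succ, ih, Nat.mod_pow_succ, binDigit]
      ring
  rw [key, Nat.mod_eq_of_lt (Nat.size_le.mp le_rfl)]

/-- `u(j, λ) = ∑ q, e_q(j) * λ_q`; the sum runs over all positions of the binary expansion of `j`,
the remaining digits being zero. -/
noncomputable def digitSum (lam : ℕ → ℝ) (j : ℕ) : ℝ :=
  ∑ q ∈ Finset.range j.size, (binDigit q j : ℝ) * lam q

/-- The distance from a real number to the nearest integer. -/
noncomputable def distNearestInt (x : ℝ) : ℝ := |x - round x|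

theorem isLeast_distNearestInt (x : ℝ) :
    IsLeast (Set.range fun n : ℤ => |x - n|) (distNearestInt x) :=
  ⟨⟨round x, rfl⟩, by rintro _ ⟨n, rfl⟩; exact round_le x n⟩

/-- Uniform distribution modulo one: every subinterval `[a, b)` of the unit interval contains the
fractional parts of the terms with asymptotic frequency `b - a`. -/
def UniformlyDistributedModOne (v : ℕ → ℝ) : Prop :=
  ∀ a b : ℝ, 0 ≤ a → a < b → b ≤ 1 →
    Filter.Tendsto
      (fun N : ℕ =>
        (Nat.card {j : ℕ // j < N ∧ Int.fract (v j) ∈ Set.Ico a b} : ℝ) / (N : ℝ))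
      Filter.atTop (nhds (b - a))

/-- A set of reals is dense modulo one if its image in `ℝ / ℤ` is dense. -/
def DenseModOne (S : Set ℝ) : Prop :=
  Dense ((fun y : ℝ => (y : UnitAddCircle)) '' S)

/-- Pisot numbers: real algebraic integers `θ > 1` all of whose other complex conjugates lie in the
open unit disk. -/
def IsPisotNumber (θ : ℝ) : Prop :=
  1 < θ ∧ IsIntegral ℤ θ ∧
    ∀ z : ℂ, Polynomial.aeval z (minpoly ℚ θ) = 0 → z ≠ (θ : ℂ) → ‖z‖ < 1

/-!
Uniform distribution of `digitSum lam` reduces, by Weyl's criterion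
(`uniformlyDistributedModOne_iff`), to the exponential sums `∑ j < N, exp (2πi l u(j))`. For
`N = 2 ^ n` such a sum factors as `∏ q < n, (1 + exp (2πi l λ_q))`, of modulus
`2 ^ n * ∏ q < n, |cos (π l λ_q)|`, and cutting `[0, N)` into dyadic blocks shows that this case
governs all `N` (`tendsto_sum_unitExp_digitSum_iff`). Since `1 - |cos (π y)|` is comparable to
`‖y‖ ^ 2`, the product tends to zero exactly when a factor vanishes or `∑ ‖l λ_q‖ ^ 2` diverges
(`tendsto_prod_abs_cos_iff`).

For `λ_q = x θ ^ q` the remaining ingredient is Pisot's theorem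
(`isPisotNumber_and_mem_adjoin_of_summable`): if `x ≠ 0` and `∑ ‖x θ ^ n‖ ^ 2 < ∞`, then `θ` is a
Pisot number and `x ∈ ℚ(θ)`. Let `a_n` be the integer nearest to `x θ ^ n`. Row operations and
Hadamard's inequality make the integral Hankel determinants of `a` tend to zero
(`tendsto_det_hankelMatrix_round`), so they vanish eventually, and Kronecker's criterion
(`exists_recurrence_of_det_hankelMatrix_eq_zero`) gives a linear recurrence, whence `θ` is
algebraic. Then `a` eventually satisfies the recurrence of the minimal polynomial `μ` of `θ`.
Applying `μ / (X - θ)` to `a` yields a sequence in a finitely generated subgroup of `ℚ(θ)` that is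
eventually geometric of ratio `θ`; this gives integrality of `θ`, and comparing its images under
the embeddings of `ℚ(θ)` with the rounding errors, which tend to zero, bounds the conjugates of `θ`
and exhibits `x` in `ℚ(θ)`.

Conversely, for a Pisot number `θ` and `x ∈ ℚ(θ)`, a multiple `l x` is an algebraic integer; the
traces of `l x θ ^ q` are integers exponentially close to `l x θ ^ q`
(`IsPisotNumber.summable_distNearestInt_sq`), and `l x θ ^ q`, being integral, is never congruent
to `1 / 2`.

Density modulo one follows from uniform distribution, as every finite sum of distinct `λ_q` is a
value of `digitSum`.
-/

open MeasureTheory Polynomial IntermediateField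

/-! ### Digit sums and their exponential sums -/

theorem binDigit_two_pow_mul_add_of_lt {n q : ℕ} (m r : ℕ) (hq : q < n) :
    binDigit q (2 ^ n * m + r) = binDigit q r := by
  obtain ⟨d, rfl⟩ := Nat.exists_eq_add_of_lt hq
  unfold binDigit
  have h : 2 ^ (q + d + 1) * m + r = r + 2 ^ q * (2 * (2 ^ d * m)) := by ring
  rw [h, Nat.add_mul_div_left _ _ (by positivity), Nat.add_mul_mod_self_left]

theorem binDigit_add_two_pow_mul_add {n r : ℕ} (t m : ℕ) (hr : r < 2 ^ n) :
    binDigit (n + t) (2 ^ n * m + r) = binDigit t m := by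
  unfold binDigit
  rw [pow_add, ← Nat.div_div_eq_div_mul, Nat.mul_add_div (by positivity), Nat.div_eq_of_lt hr,
    add_zero]

theorem digitSum_eq_sum_range (lam : ℕ → ℝ) {j K : ℕ} (h : j < 2 ^ K) :
    digitSum lam j = ∑ q ∈ Finset.range K, (binDigit q j : ℝ) * lam q := by
  unfold digitSum
  refine Finset.sum_subset (by simpa using Nat.size_le.mpr h) fun q _ hq => ?_
  rw [binDigit_eq_zero_of_size_le (by simpa using hq)]
  simp

@[simp] theorem digitSum_zero (lam : ℕ → ℝ) : digitSum lam 0 = 0 := by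
  simp [digitSum]

/-- The digits of `2 ^ n * m + r` with `r < 2 ^ n` are those of `r` followed by those of `m`. -/
theorem digitSum_two_pow_mul_add (lam : ℕ → ℝ) {n r : ℕ} (m : ℕ) (hr : r < 2 ^ n) :
    digitSum lam (2 ^ n * m + r) = digitSum lam r + digitSum (fun q => lam (n + q)) m := by
  have hm : m < 2 ^ m.size := Nat.lt_size_self m
  have hlt : 2 ^ n * m + r < 2 ^ (n + m.size) := by
    rw [pow_add]
    nlinarith [Nat.succ_le_of_lt hm, Nat.pos_of_neZero (2 ^ n)]
  rw [digitSum_eq_sum_range lam hlt, Finset.sum_range_add, digitSum_eq_sum_range lam hr,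
    digitSum_eq_sum_range _ hm]
  congr 1
  · refine Finset.sum_congr rfl fun q hq => ?_
    rw [binDigit_two_pow_mul_add_of_lt m r (Finset.mem_range.mp hq)]
  · refine Finset.sum_congr rfl fun q _ => ?_
    rw [binDigit_add_two_pow_mul_add q m hr]

theorem digitSum_two_pow_add (lam : ℕ → ℝ) {n r : ℕ} (hr : r < 2 ^ n) :
    digitSum lam (2 ^ n + r) = digitSum lam r + lam n := by
  have h := digitSum_two_pow_mul_add lam 1 hr
  rw [mul_one] at h
  rw [h]
  simp [digitSum, binDigit]

theorem mul_digitSum (c : ℝ) (lam : ℕ → ℝ) (j : ℕ) :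
    c * digitSum lam j = digitSum (fun q => c * lam q) j := by
  unfold digitSum
  rw [Finset.mul_sum]
  exact Finset.sum_congr rfl fun q _ => by ring

/-- The character `y ↦ exp (2πiy)` of `ℝ / ℤ`. -/
noncomputable def unitExp (y : ℝ) : ℂ := Complex.exp (((2 * Real.pi * y : ℝ) : ℂ) * Complex.I)

theorem unitExp_add (y z : ℝ) : unitExp (y + z) = unitExp y * unitExp z := by
  unfold unitExp
  rw [← Complex.exp_add]
  congr 1
  push_cast
  ring

@[simp] theorem unitExp_zero : unitExp 0 = 1 := by simp [unitExp]

@[simp] theorem norm_unitExp (y : ℝ) : ‖unitExp y‖ = 1 := by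
  rw [unitExp, Complex.norm_exp_ofReal_mul_I]

theorem unitExp_intCast (n : ℤ) : unitExp n = 1 := by
  rw [unitExp, Complex.exp_eq_one_iff]
  exact ⟨n, by push_cast; ring⟩

theorem unitExp_eq_one_iff {y : ℝ} : unitExp y = 1 ↔ ∃ n : ℤ, y = n := by
  refine ⟨fun h => ?_, by rintro ⟨n, rfl⟩; exact unitExp_intCast n⟩
  obtain ⟨n, hn⟩ := Complex.exp_eq_one_iff.mp h
  refine ⟨n, ?_⟩
  have h2 : ((2 * Real.pi * y : ℝ) : ℂ) = ((n * (2 * Real.pi) : ℝ) : ℂ) := by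
    refine mul_right_cancel₀ Complex.I_ne_zero ?_
    rw [hn]
    push_cast
    ring
  have h3 := Complex.ofReal_injective h2
  have hpi := Real.pi_pos
  have : 2 * Real.pi * (y - n) = 0 := by linarith
  rcases mul_eq_zero.mp this with h | h
  · linarith
  · linarith

theorem norm_one_add_unitExp (y : ℝ) : ‖1 + unitExp y‖ = 2 * |Real.cos (Real.pi * y)| := by
  have h : 1 + unitExp y =
      Complex.exp (((Real.pi * y : ℝ) : ℂ) * Complex.I) *
        ((2 * Real.cos (Real.pi * y) : ℝ) : ℂ) := by
    rw [Complex.ofReal_mul 2, Complex.ofReal_cos, Complex.ofReal_ofNat, Complex.two_cos, mul_add,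
      ← Complex.exp_add, ← Complex.exp_add, unitExp, add_comm]
    congr 1
    · congr 1
      push_cast
      ring
    · rw [neg_mul, add_neg_cancel, Complex.exp_zero]
  rw [h, norm_mul, Complex.norm_exp_ofReal_mul_I, one_mul, Complex.norm_real, Real.norm_eq_abs,
    abs_mul, abs_two]

theorem sum_unitExp_digitSum_two_pow (lam : ℕ → ℝ) (n : ℕ) :
    ∑ j ∈ Finset.range (2 ^ n), unitExp (digitSum lam j) =
      ∏ q ∈ Finset.range n, (1 + unitExp (lam q)) := by
  induction n with
  | zero => simp
  | succ n ih =>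
    rw [Finset.prod_range_succ, ← ih, pow_succ, mul_two, Finset.sum_range_add, mul_add, mul_one,
      Finset.sum_mul]
    congr 1
    refine Finset.sum_congr rfl fun r hr => ?_
    rw [digitSum_two_pow_add lam (Finset.mem_range.mp hr), unitExp_add]

theorem norm_sum_unitExp_digitSum_two_pow (lam : ℕ → ℝ) (n : ℕ) :
    ‖∑ j ∈ Finset.range (2 ^ n), unitExp (digitSum lam j)‖ =
      2 ^ n * ∏ q ∈ Finset.range n, |Real.cos (Real.pi * lam q)| := by
  rw [sum_unitExp_digitSum_two_pow, norm_prod]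
  simp_rw [norm_one_add_unitExp]
  rw [Finset.prod_mul_distrib]
  simp

/-- Cutting `[0, N)` into dyadic blocks of length `2 ^ n`: each complete block contributes a sum of
the same modulus, and the incomplete one at most `2 ^ n`. -/
theorem norm_sum_unitExp_digitSum_le (lam : ℕ → ℝ) (n N : ℕ) :
    ‖∑ j ∈ Finset.range N, unitExp (digitSum lam j)‖ ≤
      N * ∏ q ∈ Finset.range n, |Real.cos (Real.pi * lam q)| + 2 ^ n := by
  set P := ∏ q ∈ Finset.range n, |Real.cos (Real.pi * lam q)| with hP
  have hP0 : 0 ≤ P := Finset.prod_nonneg fun _ _ => abs_nonneg _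
  have key : ∀ m : ℕ, ‖∑ j ∈ Finset.range (2 ^ n * m), unitExp (digitSum lam j)‖ ≤
      (2 ^ n * m : ℕ) * P := by
    intro m
    induction m with
    | zero => simp
    | succ m ih =>
      rw [mul_add, mul_one, Finset.sum_range_add]
      have hb : ∑ r ∈ Finset.range (2 ^ n), unitExp (digitSum lam (2 ^ n * m + r)) =
          (∑ r ∈ Finset.range (2 ^ n), unitExp (digitSum lam r)) *
            unitExp (digitSum (fun q => lam (n + q)) m) := by
        rw [Finset.sum_mul]
        refine Finset.sum_congr rfl fun r hr => ?_
        rw [digitSum_two_pow_mul_add lam m (Finset.mem_range.mp hr), unitExp_add]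
      refine (norm_add_le _ _).trans ?_
      rw [hb, norm_mul, norm_unitExp, mul_one, norm_sum_unitExp_digitSum_two_pow, ← hP]
      push_cast at ih ⊢
      linarith
  have hN : 2 ^ n * (N / 2 ^ n) + N % 2 ^ n = N := Nat.div_add_mod N (2 ^ n)
  conv_lhs => rw [← hN, Finset.sum_range_add]
  refine (norm_add_le _ _).trans (add_le_add ((key _).trans ?_) ?_)
  · gcongr
    omega
  · refine (norm_sum_le _ _).trans ?_
    simp only [norm_unitExp, Finset.sum_const, Finset.card_range, nsmul_eq_mul, mul_one]
    exact_mod_cast (Nat.mod_lt N (by positivity)).le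

theorem tendsto_sum_unitExp_digitSum_iff (lam : ℕ → ℝ) :
    Filter.Tendsto (fun N : ℕ => (∑ j ∈ Finset.range N, unitExp (digitSum lam j)) / (N : ℂ))
      Filter.atTop (nhds 0) ↔
    Filter.Tendsto (fun n : ℕ => ∏ q ∈ Finset.range n, |Real.cos (Real.pi * lam q)|)
      Filter.atTop (nhds 0) := by
  constructor
  · intro h
    have h1 := (h.comp (tendsto_pow_atTop_atTop_of_one_lt (one_lt_two : (1 : ℕ) < 2))).norm
    rw [norm_zero] at h1
    refine h1.congr fun n => ?_
    simp only [Function.comp_apply]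
    rw [norm_div, norm_sum_unitExp_digitSum_two_pow]
    simp
  · intro h
    rw [Metric.tendsto_atTop]
    intro ε hε
    obtain ⟨n, hn⟩ := (h.eventually (gt_mem_nhds (half_pos hε))).exists
    obtain ⟨N₀, hN₀⟩ := exists_nat_gt (2 ^ n / (ε / 2))
    refine ⟨N₀ + 1, fun N hN => ?_⟩
    have hNpos : (0 : ℝ) < N := by exact_mod_cast (by omega : 0 < N)
    rw [dist_zero_right, norm_div, Complex.norm_natCast, div_lt_iff₀ hNpos]
    refine (norm_sum_unitExp_digitSum_le lam n N).trans_lt ?_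
    have h1 : (N : ℝ) * ∏ q ∈ Finset.range n, |Real.cos (Real.pi * lam q)| ≤ N * (ε / 2) := by
      gcongr
    have h2 : (2 : ℝ) ^ n < N * (ε / 2) := by
      rw [div_lt_iff₀ (half_pos hε)] at hN₀
      refine hN₀.trans_le ?_
      have : (N₀ : ℝ) ≤ N := by exact_mod_cast (by omega : N₀ ≤ N)
      gcongr
    linarith

/-! ### The product of cosines -/

theorem distNearestInt_nonneg (y : ℝ) : 0 ≤ distNearestInt y := abs_nonneg _

theorem distNearestInt_le_abs_sub (y : ℝ) (n : ℤ) : distNearestInt y ≤ |y - n| := round_le y n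

theorem abs_cos_pi_mul (y : ℝ) :
    |Real.cos (Real.pi * y)| = Real.cos (Real.pi * distNearestInt y) := by
  have h1 : |Real.cos (Real.pi * y)| = |Real.cos (Real.pi * distNearestInt y)| := by
    have h2 : Real.cos (Real.pi * distNearestInt y) =
        Real.cos (Real.pi * y - round y * Real.pi) := by
      rw [distNearestInt, ← Real.cos_abs (Real.pi * y - round y * Real.pi)]
      congr 1
      rw [mul_comm (round y : ℝ), ← mul_sub, abs_mul, abs_of_pos Real.pi_pos]
    rw [h2, Real.cos_sub_int_mul_pi, abs_mul]
    simp
  rw [h1, abs_of_nonneg]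
  refine Real.cos_nonneg_of_mem_Icc ⟨?_, ?_⟩
  · have := mul_nonneg Real.pi_pos.le (distNearestInt_nonneg y)
    linarith [Real.pi_pos]
  · have : distNearestInt y ≤ 1 / 2 := abs_sub_round y
    nlinarith [Real.pi_pos]

theorem one_sub_le_abs_cos_pi_mul (y : ℝ) :
    1 - Real.pi ^ 2 / 2 * distNearestInt y ^ 2 ≤ |Real.cos (Real.pi * y)| := by
  rw [abs_cos_pi_mul]
  have := Real.one_sub_sq_div_two_le_cos (x := Real.pi * distNearestInt y)
  linarith [this]

theorem abs_cos_pi_mul_le_exp (y : ℝ) :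
    |Real.cos (Real.pi * y)| ≤ Real.exp (-(2 * distNearestInt y ^ 2)) := by
  rw [abs_cos_pi_mul]
  have h0 := distNearestInt_nonneg y
  have hhalf : distNearestInt y ≤ 1 / 2 := abs_sub_round y
  have h := Real.cos_le_one_sub_mul_cos_sq (x := Real.pi * distNearestInt y) (by
    rw [abs_of_nonneg (by positivity)]
    nlinarith [Real.pi_pos])
  have h2 : 1 - 2 / Real.pi ^ 2 * (Real.pi * distNearestInt y) ^ 2 =
      1 - 2 * distNearestInt y ^ 2 := by
    field_simp
  rw [h2] at h
  refine h.trans ?_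
  linarith [Real.add_one_le_exp (-(2 * distNearestInt y ^ 2))]

theorem one_sub_sum_le_prod {a c : ℕ → ℝ} (hc0 : ∀ q, 0 ≤ c q) (hc1 : ∀ q, c q ≤ 1)
    (ha : ∀ q, 0 ≤ a q) (h : ∀ q, 1 - a q ≤ c q) (n : ℕ) :
    1 - ∑ q ∈ Finset.range n, a q ≤ ∏ q ∈ Finset.range n, c q := by
  induction n with
  | zero => simp
  | succ n ih =>
    rw [Finset.sum_range_succ, Finset.prod_range_succ]
    have hp0 : 0 ≤ ∏ q ∈ Finset.range n, c q := Finset.prod_nonneg fun q _ => hc0 q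
    have hp1 : ∏ q ∈ Finset.range n, c q ≤ 1 :=
      Finset.prod_le_one (fun q _ => hc0 q) fun q _ => hc1 q
    nlinarith [h n, ha n]

/-- A product of cosines of modulus at most one tends to zero exactly when it has a zero factor or
the defects from one have infinite sum. -/
theorem tendsto_prod_abs_cos_iff (lam : ℕ → ℝ) :
    Filter.Tendsto (fun n : ℕ => ∏ q ∈ Finset.range n, |Real.cos (Real.pi * lam q)|)
      Filter.atTop (nhds 0) ↔
    (∑' q : ℕ, ENNReal.ofReal (distNearestInt (lam q) ^ 2) = ⊤ ∨
      ∃ q : ℕ, ∃ m : ℤ, lam q = 1 / 2 + (m : ℝ)) := by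
  have hcos : ∀ y : ℝ, Real.cos (Real.pi * y) = 0 ↔ ∃ m : ℤ, y = 1 / 2 + (m : ℝ) := by
    intro y
    rw [Real.cos_eq_zero_iff]
    refine exists_congr fun m => ?_
    have hpi := Real.pi_pos
    constructor
    · intro h
      have : Real.pi * (y - (1 / 2 + m)) = 0 := by linarith
      rcases mul_eq_zero.mp this with h | h
      · linarith
      · linarith
    · rintro rfl
      ring
  constructor
  · intro h
    by_contra! hcon
    obtain ⟨hsum, hne⟩ := hcon
    set a : ℕ → ℝ := fun q => Real.pi ^ 2 / 2 * distNearestInt (lam q) ^ 2 with ha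
    have hs : Summable a := by
      refine Summable.mul_left _ ?_
      have := ENNReal.summable_toReal hsum
      simpa [ENNReal.toReal_ofReal, sq_nonneg] using this
    have ha0 : ∀ q, 0 ≤ a q := fun q => by positivity
    obtain ⟨k, hk⟩ := ((tendsto_sum_nat_add a).eventually
      (gt_mem_nhds (by norm_num : (0 : ℝ) < 1 / 2))).exists
    have hpos : 0 < ∏ q ∈ Finset.range k, |Real.cos (Real.pi * lam q)| := by
      refine Finset.prod_pos fun q _ => abs_pos.mpr fun h0 => ?_
      obtain ⟨m, hm⟩ := (hcos _).mp h0
      exact hne q m hm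
    have h2 := (Filter.tendsto_add_atTop_iff_nat k).mpr h
    have hge : ∀ n, (∏ q ∈ Finset.range k, |Real.cos (Real.pi * lam q)|) * (1 / 2) ≤
        ∏ q ∈ Finset.range (n + k), |Real.cos (Real.pi * lam q)| := by
      intro n
      rw [add_comm n k, Finset.prod_range_add]
      refine mul_le_mul_of_nonneg_left ?_ hpos.le
      have h3 := one_sub_sum_le_prod (a := fun q => a (k + q))
        (c := fun q => |Real.cos (Real.pi * lam (k + q))|) (fun q => abs_nonneg _)
        (fun q => Real.abs_cos_le_one _) (fun q => ha0 _)
        (fun q => one_sub_le_abs_cos_pi_mul _) n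
      have h4 : ∑ q ∈ Finset.range n, a (k + q) ≤ ∑' q, a (q + k) := by
        simp_rw [add_comm k]
        exact ((summable_nat_add_iff k).mpr hs).sum_le_tsum _ fun q _ => ha0 _
      linarith
    have := ge_of_tendsto' h2 hge
    linarith
  · rintro (hsum | ⟨q, m, hq⟩)
    · have hns : ¬ Summable fun q => distNearestInt (lam q) ^ 2 := by
        intro hs
        rw [← ENNReal.ofReal_tsum_of_nonneg (fun q => sq_nonneg _) hs] at hsum
        exact ENNReal.ofReal_ne_top hsum
      have ht := (not_summable_iff_tendsto_nat_atTop_of_nonneg fun q => sq_nonneg _).mp hns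
      have hexp : Filter.Tendsto
          (fun n : ℕ => Real.exp (-(2 * ∑ q ∈ Finset.range n, distNearestInt (lam q) ^ 2)))
          Filter.atTop (nhds 0) :=
        Real.tendsto_exp_neg_atTop_nhds_zero.comp (ht.const_mul_atTop two_pos)
      refine squeeze_zero (fun n => Finset.prod_nonneg fun _ _ => abs_nonneg _) (fun n => ?_) hexp
      rw [Finset.mul_sum, ← Finset.sum_neg_distrib, Real.exp_sum]
      exact Finset.prod_le_prod (fun _ _ => abs_nonneg _) fun q _ => abs_cos_pi_mul_le_exp _
    · refine tendsto_const_nhds.congr' ?_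
      filter_upwards [Filter.eventually_gt_atTop q] with n hn
      refine (Finset.prod_eq_zero (Finset.mem_range.mpr hn) ?_).symm
      rw [(hcos _).mpr ⟨m, hq⟩, abs_zero]

/-! ### Weyl's criterion -/

theorem natCard_lt_and_eq (p : ℕ → Prop) [DecidablePred p] (N : ℕ) :
    Nat.card {j : ℕ // j < N ∧ p j} = ((Finset.range N).filter p).card := by
  rw [← Nat.subtype_card]
  simp

theorem norm_unitExp_sub_unitExp_le (y z : ℝ) :
    ‖unitExp y - unitExp z‖ ≤ 2 * Real.pi * |y - z| := by
  have h : unitExp y - unitExp z =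
      unitExp z * (Complex.exp (Complex.I * ((2 * Real.pi * (y - z) : ℝ) : ℂ)) - 1) := by
    have : y = z + (y - z) := by ring
    rw [mul_sub, mul_one]
    congr 1
    conv_lhs => rw [this, unitExp_add]
    rw [unitExp.eq_1 (y - z), mul_comm Complex.I]
  rw [h, norm_mul, norm_unitExp, one_mul]
  refine Real.norm_exp_I_mul_ofReal_sub_one_le.trans ?_
  rw [Real.norm_eq_abs, abs_mul, abs_of_pos (by positivity)]

theorem unitExp_natCast_mul (k : ℕ) (y : ℝ) : unitExp (k * y) = unitExp y ^ k := by
  induction k with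
  | zero => simp
  | succ k ih => rw [pow_succ, ← ih, ← unitExp_add]; congr 1; push_cast; ring

theorem unitExp_natCast_mul_fract (l : ℕ) (y : ℝ) :
    unitExp (l * Int.fract y) = unitExp (l * y) := by
  have h : unitExp y = unitExp (Int.fract y) := by
    conv_lhs => rw [← Int.floor_add_fract y, unitExp_add, unitExp_intCast, one_mul]
  rw [unitExp_natCast_mul, unitExp_natCast_mul, h]

/-- The `l`-th powers of the `K`-th roots of unity sum to zero for `0 < l < K`. -/
theorem sum_unitExp_div_eq_zero {l K : ℕ} (hl : 0 < l) (hK : l < K) :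
    ∑ i ∈ Finset.range K, unitExp (l * ((i : ℝ) / K)) = 0 := by
  have hK0 : (K : ℝ) ≠ 0 := by
    have : 0 < K := by omega
    positivity
  have h1 : ∀ i : ℕ, unitExp (l * ((i : ℝ) / K)) = unitExp ((l : ℝ) / K) ^ i := by
    intro i
    rw [← unitExp_natCast_mul]
    congr 1
    ring
  simp_rw [h1]
  have hne : unitExp ((l : ℝ) / K) ≠ 1 := by
    rw [Ne, unitExp_eq_one_iff]
    rintro ⟨n, hn⟩
    rw [div_eq_iff hK0] at hn
    have hn' : (l : ℤ) = n * K := by exact_mod_cast hn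
    have hdvd : (K : ℤ) ∣ l := ⟨n, by rw [hn', mul_comm]⟩
    exact absurd (Nat.le_of_dvd hl (by exact_mod_cast hdvd)) (by omega)
  rw [geom_sum_eq hne, ← unitExp_natCast_mul, mul_div_cancel₀ _ hK0]
  have : unitExp (l : ℝ) = 1 := unitExp_intCast l
  rw [this, sub_self, zero_div]

/-- Uniform distribution makes the means of every nontrivial character tend to zero: replace the
character by a step function on a partition of the unit interval into `K` equal pieces. -/
theorem UniformlyDistributedModOne.tendsto_mean_unitExp {v : ℕ → ℝ}
    (hv : UniformlyDistributedModOne v) {l : ℕ} (hl : 1 ≤ l) :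
    Filter.Tendsto (fun N : ℕ => (∑ j ∈ Finset.range N, unitExp (l * v j)) / (N : ℂ))
      Filter.atTop (nhds 0) := by
  classical
  rw [Metric.tendsto_atTop]
  intro ε hε
  obtain ⟨K₀, hK₀⟩ := exists_nat_gt (2 * Real.pi * l / (ε / 2))
  set K := max K₀ (l + 1) with hK
  have hlK : l < K := lt_of_lt_of_le (Nat.lt_succ_self l) (le_max_right _ _)
  have hK0 : 0 < K := by omega
  have hKr : (0 : ℝ) < K := by exact_mod_cast hK0
  have hKε : 2 * Real.pi * (l * (1 / K)) < ε / 2 := by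
    rw [div_lt_iff₀ (half_pos hε)] at hK₀
    have : (K₀ : ℝ) ≤ K := by exact_mod_cast le_max_left _ _
    rw [← mul_assoc, mul_one_div, div_lt_iff₀ hKr]
    nlinarith
  set w : ℕ → ℕ := fun j => ⌊(K : ℝ) * Int.fract (v j)⌋₊ with hw
  have hwK : ∀ j, w j < K := by
    intro j
    rw [hw, Nat.floor_lt (mul_nonneg hKr.le (Int.fract_nonneg _))]
    nlinarith [Int.fract_lt_one (v j)]
  have hw_iff : ∀ j i, w j = i ↔
      Int.fract (v j) ∈ Set.Ico ((i : ℝ) / K) (((i : ℝ) + 1) / K) := by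
    intro j i
    rw [hw, Nat.floor_eq_iff (mul_nonneg hKr.le (Int.fract_nonneg _)), Set.mem_Ico,
      div_le_iff₀ hKr, lt_div_iff₀ hKr, mul_comm (K : ℝ)]
  -- The step-function mean converges to a vanishing sum over roots of unity.
  have hstep : Filter.Tendsto (fun N : ℕ =>
      (∑ j ∈ Finset.range N, unitExp (l * ((w j : ℝ) / K))) / (N : ℂ))
      Filter.atTop (nhds 0) := by
    have h1 : ∀ N : ℕ, (∑ j ∈ Finset.range N, unitExp (l * ((w j : ℝ) / K))) / (N : ℂ) =
        ∑ i ∈ Finset.range K, unitExp (l * ((i : ℝ) / K)) *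
          (((Nat.card {j : ℕ // j < N ∧
            Int.fract (v j) ∈ Set.Ico ((i : ℝ) / K) (((i : ℝ) + 1) / K)} : ℝ) / (N : ℝ) : ℝ) :
            ℂ) := by
      intro N
      rw [← Finset.sum_fiberwise_of_maps_to (t := Finset.range K) (g := w)
        fun j _ => Finset.mem_range.mpr (hwK j), Finset.sum_div]
      refine Finset.sum_congr rfl fun i _ => ?_
      rw [natCard_lt_and_eq]
      have h2 : ∑ j ∈ Finset.range N with w j = i, unitExp (l * ((w j : ℝ) / K)) =
          ∑ j ∈ Finset.range N with w j = i, unitExp (l * ((i : ℝ) / K)) :=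
        Finset.sum_congr rfl fun j hj => by rw [(Finset.mem_filter.mp hj).2]
      rw [h2, Finset.sum_const, nsmul_eq_mul]
      simp_rw [hw_iff]
      push_cast
      ring
    simp_rw [h1]
    have h3 : (0 : ℂ) = ∑ i ∈ Finset.range K,
        unitExp (l * ((i : ℝ) / K)) * (((1 : ℝ) / K : ℝ) : ℂ) := by
      rw [← Finset.sum_mul, sum_unitExp_div_eq_zero hl hlK, zero_mul]
    rw [h3]
    refine tendsto_finsetSum _ fun i hi => Filter.Tendsto.const_mul _ ?_
    refine (Complex.continuous_ofReal.tendsto _).comp ?_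
    have hi' : (i : ℝ) + 1 ≤ K := by exact_mod_cast Finset.mem_range.mp hi
    have := hv ((i : ℝ) / K) (((i : ℝ) + 1) / K) (by positivity) (by gcongr; linarith)
      ((div_le_one hKr).mpr hi')
    rwa [← sub_div, add_sub_cancel_left] at this
  obtain ⟨N₀, hN₀⟩ := Metric.tendsto_atTop.mp hstep (ε / 2) (half_pos hε)
  refine ⟨max N₀ 1, fun N hN => ?_⟩
  have hNpos : (0 : ℝ) < N := by exact_mod_cast lt_of_lt_of_le one_pos ((le_max_right _ _).trans hN)
  have h1 := hN₀ N ((le_max_left _ _).trans hN)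
  rw [dist_zero_right] at h1 ⊢
  have h2 : ‖(∑ j ∈ Finset.range N, unitExp (l * v j)) / (N : ℂ) -
      (∑ j ∈ Finset.range N, unitExp (l * ((w j : ℝ) / K))) / (N : ℂ)‖ ≤
      2 * Real.pi * (l * (1 / K)) := by
    rw [← sub_div, ← Finset.sum_sub_distrib, norm_div, Complex.norm_natCast,
      div_le_iff₀ hNpos]
    refine (norm_sum_le _ _).trans ?_
    refine (Finset.sum_le_card_nsmul _ _ (2 * Real.pi * (l * (1 / K))) fun j _ => ?_).trans ?_
    · rw [← unitExp_natCast_mul_fract]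
      refine (norm_unitExp_sub_unitExp_le _ _).trans ?_
      have hm := (hw_iff j (w j)).mp rfl
      rw [Set.mem_Ico, add_div] at hm
      rw [← mul_sub, abs_mul, Nat.abs_cast, abs_of_nonneg (by linarith [hm.1])]
      gcongr
      linarith [hm.2]
    · rw [Finset.card_range, nsmul_eq_mul, mul_comm]
  have h3 := norm_sub_norm_le ((∑ j ∈ Finset.range N, unitExp (l * v j)) / (N : ℂ))
    ((∑ j ∈ Finset.range N, unitExp (l * ((w j : ℝ) / K))) / (N : ℂ))
  linarith

/-- The empirical measure on the circle of the first `N + 1` terms of a sequence. -/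
noncomputable def empiricalMeasure (v : ℕ → ℝ) (N : ℕ) : Measure UnitAddCircle :=
  (((N + 1 : ℕ) : ENNReal)⁻¹) • ∑ j ∈ Finset.range (N + 1), Measure.dirac (v j : UnitAddCircle)

instance isProbabilityMeasure_empiricalMeasure (v : ℕ → ℝ) (N : ℕ) :
    IsProbabilityMeasure (empiricalMeasure v N) := by
  constructor
  rw [empiricalMeasure, Measure.smul_apply, Measure.finsetSum_apply]
  simp only [measure_univ, Finset.sum_const, Finset.card_range, nsmul_eq_mul, mul_one, smul_eq_mul]
  exact ENNReal.inv_mul_cancel (by simp) (ENNReal.natCast_ne_top _)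

theorem integral_empiricalMeasure (v : ℕ → ℝ) (N : ℕ) (f : C(UnitAddCircle, ℂ)) :
    ∫ t, f t ∂(empiricalMeasure v N) =
      (∑ j ∈ Finset.range (N + 1), f (v j : UnitAddCircle)) / ((N + 1 : ℕ) : ℂ) := by
  rw [empiricalMeasure, integral_smul_measure, integral_finsetSum_measure]
  · simp only [integral_dirac, ENNReal.toReal_inv, ENNReal.toReal_natCast]
    rw [div_eq_inv_mul, Complex.real_smul]
    push_cast
    rfl
  · intro j _
    exact f.continuous.integrable_of_hasCompactSupport (HasCompactSupport.of_compactSpace f)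

theorem integral_fourier_eq_zero {n : ℤ} (hn : n ≠ 0) :
    ∫ t : UnitAddCircle, fourier n t = 0 :=
  integral_eq_zero_of_add_right_eq_neg (fourier_add_half_inv_index hn one_pos)

theorem fourier_natCast_coe (l : ℕ) (y : ℝ) :
    fourier (l : ℤ) (y : UnitAddCircle) = unitExp (l * y) := by
  rw [fourier_coe_apply, unitExp]
  congr 1
  push_cast
  ring

instance isProbabilityMeasure_volume_unitAddCircle :
    IsProbabilityMeasure (volume : Measure UnitAddCircle) :=
  ⟨UnitAddCircle.measure_univ⟩

/-- If the means of all nontrivial characters tend to zero, the empirical measures converge weakly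
to Haar measure, because the characters span a point-separating algebra. -/
theorem tendsto_empiricalMeasure {v : ℕ → ℝ}
    (h : ∀ l : ℕ, 1 ≤ l → Filter.Tendsto
      (fun N : ℕ => (∑ j ∈ Finset.range N, unitExp (l * v j)) / (N : ℂ)) Filter.atTop (nhds 0)) :
    Filter.Tendsto (β := ProbabilityMeasure UnitAddCircle)
      (fun N => ⟨empiricalMeasure v N, inferInstance⟩)
      Filter.atTop (nhds ⟨volume, inferInstance⟩) := by
  have hpos : ∀ l : ℕ, 1 ≤ l → Filter.Tendsto
      (fun N => ∫ t, fourier (l : ℤ) t ∂(empiricalMeasure v N)) Filter.atTop (nhds 0) := by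
    intro l hl
    simp_rw [integral_empiricalMeasure, fourier_natCast_coe]
    exact (h l hl).comp (Filter.tendsto_add_atTop_nat 1)
  have hfour : ∀ n : ℤ, Filter.Tendsto
      (fun N => ∫ t, fourier n t ∂(empiricalMeasure v N)) Filter.atTop
      (nhds (∫ t : UnitAddCircle, fourier n t)) := by
    intro n
    rcases eq_or_ne n 0 with rfl | hn
    · simp
    rw [integral_fourier_eq_zero hn]
    rcases Int.natAbs_eq n with hn' | hn'
    · rw [hn']
      exact hpos _ (by omega)
    · rw [hn']
      have h1 := (Complex.continuous_conj.tendsto 0).comp (hpos n.natAbs (by omega))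
      rw [map_zero] at h1
      refine h1.congr fun N => ?_
      simp only [Function.comp_apply]
      rw [← integral_conj]
      exact integral_congr_ae (Filter.Eventually.of_forall fun t => fourier_neg.symm)
  have hspan : ∀ f ∈ Submodule.span ℂ (Set.range (@fourier 1)), Filter.Tendsto
      (fun N => ∫ t, f t ∂(empiricalMeasure v N)) Filter.atTop
      (nhds (∫ t : UnitAddCircle, f t)) := by
    have hint : ∀ (μ : Measure UnitAddCircle) [IsFiniteMeasure μ] (f : C(UnitAddCircle, ℂ)),
        Integrable f μ := fun μ _ f =>
      f.continuous.integrable_of_hasCompactSupport (HasCompactSupport.of_compactSpace f)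
    intro f hf
    induction hf using Submodule.span_induction with
    | mem f hf =>
      obtain ⟨n, rfl⟩ := hf
      exact hfour n
    | zero => simp
    | add f g _ _ hf hg =>
      simp only [ContinuousMap.add_apply]
      rw [integral_add (hint _ f) (hint _ g)]
      refine (hf.add hg).congr fun N => ?_
      rw [integral_add (hint _ f) (hint _ g)]
    | smul c f _ hf =>
      simp only [ContinuousMap.smul_apply]
      rw [integral_smul]
      refine (hf.const_smul c).congr fun N => ?_
      rw [integral_smul]
  refine ProbabilityMeasure.tendsto_of_tight_of_separatesPoints ℂ
    (A := (@fourierSubalgebra 1).comap (BoundedContinuousFunction.toContinuousMapStarₐ ℂ))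
    ?_ ?_ ?_
  · exact IsTightMeasureSet.of_compactSpace
  · intro x y hxy
    obtain ⟨_, ⟨f, hf, rfl⟩, hfxy⟩ := fourierSubalgebra_separatesPoints hxy
    exact ⟨_, ⟨f, ⟨BoundedContinuousFunction.mkOfCompact f, hf, rfl⟩, rfl⟩, hfxy⟩
  · intro g hg
    refine hspan g.toContinuousMap ?_
    rw [← fourierSubalgebra_coe]
    exact hg

/-- The arc of the circle formed by the classes of the reals in `[a, b)`. -/
def arc (a b : ℝ) : Set UnitAddCircle := (fun y : ℝ => (y : UnitAddCircle)) '' Set.Ico a b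

theorem unitAddCircle_coe_fract (y : ℝ) : ((Int.fract y : ℝ) : UnitAddCircle) = y := by
  have h : ((⌊y⌋ : ℝ) : UnitAddCircle) = 0 := AddCircle.coe_eq_zero_iff _ |>.mpr ⟨⌊y⌋, by simp⟩
  conv_rhs => rw [← Int.floor_add_fract y, AddCircle.coe_add, h, zero_add]

theorem coe_mem_arc_iff {a b : ℝ} (ha : 0 ≤ a) (hb : b ≤ 1) (y : ℝ) :
    (y : UnitAddCircle) ∈ arc a b ↔ Int.fract y ∈ Set.Ico a b := by
  rw [← unitAddCircle_coe_fract y]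
  constructor
  · rintro ⟨z, hz, hzy⟩
    have := (AddCircle.coe_eq_coe_iff_of_mem_Ico (p := (1 : ℝ)) (a := 0) (x := z)
      (y := Int.fract y) ⟨ha.trans hz.1, by linarith [hz.2]⟩
      ⟨Int.fract_nonneg y, by linarith [Int.fract_lt_one y]⟩).mp hzy
    exact this ▸ hz
  · exact fun h => ⟨_, h, rfl⟩

theorem isOpen_coe_image_Ioo (a b : ℝ) :
    IsOpen ((fun y : ℝ => (y : UnitAddCircle)) '' Set.Ioo a b) :=
  QuotientAddGroup.isOpenMap_coe _ isOpen_Ioo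

theorem measurableSet_arc {a b : ℝ} (hab : a < b) : MeasurableSet (arc a b) := by
  rw [arc, ← Set.Ioo_insert_left hab, Set.image_insert_eq]
  exact (isOpen_coe_image_Ioo a b).measurableSet.insert _

theorem frontier_arc_subset (a b : ℝ) :
    frontier (arc a b) ⊆ (fun y : ℝ => (y : UnitAddCircle)) '' {a, b} := by
  have hcont : Continuous fun y : ℝ => (y : UnitAddCircle) := AddCircle.continuous_mk' 1
  have h1 : closure (arc a b) ⊆ (fun y : ℝ => (y : UnitAddCircle)) '' Set.Icc a b :=
    closure_minimal (Set.image_mono Set.Ico_subset_Icc_self)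
      (isCompact_Icc.image hcont).isClosed
  have h2 : (fun y : ℝ => (y : UnitAddCircle)) '' Set.Ioo a b ⊆ interior (arc a b) :=
    interior_maximal (Set.image_mono Set.Ioo_subset_Ico_self) (isOpen_coe_image_Ioo a b)
  rintro t ⟨ht1, ht2⟩
  obtain ⟨y, hy, rfl⟩ := h1 ht1
  refine ⟨y, ?_, rfl⟩
  by_contra hne
  simp only [Set.mem_insert_iff, Set.mem_singleton_iff, not_or] at hne
  exact ht2 (h2 ⟨y, ⟨lt_of_le_of_ne hy.1 (Ne.symm hne.1), lt_of_le_of_ne hy.2 hne.2⟩, rfl⟩)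

theorem volume_arc {a b : ℝ} (ha : 0 ≤ a) (hab : a < b) (hb : b ≤ 1) :
    volume (arc a b) = ENNReal.ofReal (b - a) := by
  rw [AddCircle.add_projection_respects_measure 1 0 (measurableSet_arc hab), ← Real.volume_Ico]
  refine measure_congr ?_
  have hfin : ∀ᵐ y : ℝ, y ∉ ({0, 1} : Set ℝ) :=
    (Set.toFinite ({0, 1} : Set ℝ)).measure_zero volume |> measure_eq_zero_iff_ae_notMem.mp
  filter_upwards [hfin] with y hy
  simp only [Set.mem_insert_iff, Set.mem_singleton_iff, not_or] at hy
  refine propext ?_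
  change ((y : UnitAddCircle) ∈ arc a b ∧ y ∈ Set.Ioc (0 : ℝ) (0 + 1)) ↔ y ∈ Set.Ico a b
  rw [coe_mem_arc_iff ha hb]
  constructor
  · rintro ⟨h1, h2, h3⟩
    have h4 : y < 1 := lt_of_le_of_ne (by linarith) hy.2
    rwa [Int.fract_eq_self.mpr ⟨h2.le, h4⟩] at h1
  · intro h
    have h0 : 0 ≤ y := ha.trans h.1
    have h1 : y < 1 := h.2.trans_le hb
    rw [Int.fract_eq_self.mpr ⟨h0, h1⟩]
    exact ⟨h, lt_of_le_of_ne h0 (Ne.symm hy.1), by linarith⟩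

theorem empiricalMeasure_arc (v : ℕ → ℝ) (N : ℕ) {a b : ℝ} (ha : 0 ≤ a) (hab : a < b)
    (hb : b ≤ 1) :
    (empiricalMeasure v N (arc a b)).toReal =
      (Nat.card {j : ℕ // j < N + 1 ∧ Int.fract (v j) ∈ Set.Ico a b} : ℝ) / ((N + 1 : ℕ) : ℝ) := by
  classical
  rw [natCard_lt_and_eq, empiricalMeasure, Measure.smul_apply, Measure.finsetSum_apply]
  simp_rw [Measure.dirac_apply' _ (measurableSet_arc hab), Set.indicator_apply, Pi.one_apply,
    coe_mem_arc_iff ha hb]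
  rw [Finset.sum_boole, smul_eq_mul, ENNReal.toReal_mul, ENNReal.toReal_inv,
    ENNReal.toReal_natCast, ENNReal.toReal_natCast, div_eq_inv_mul]

/-- Weyl's criterion. -/
theorem uniformlyDistributedModOne_iff (v : ℕ → ℝ) :
    UniformlyDistributedModOne v ↔ ∀ l : ℕ, 1 ≤ l → Filter.Tendsto
      (fun N : ℕ => (∑ j ∈ Finset.range N, unitExp (l * v j)) / (N : ℂ))
      Filter.atTop (nhds 0) := by
  refine ⟨fun h l hl => h.tendsto_mean_unitExp hl, fun h a b ha hab hb => ?_⟩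
  rw [← Filter.tendsto_add_atTop_iff_nat 1]
  have hpt : ∀ t : UnitAddCircle, volume ({t} : Set UnitAddCircle) = 0 := by
    intro t
    rw [← Metric.closedBall_zero, AddCircle.volume_closedBall]
    simp
  have hnull : volume (frontier (arc a b)) = 0 := by
    refine measure_mono_null (frontier_arc_subset a b) ?_
    rw [Set.image_pair, Set.insert_eq]
    exact measure_union_null (hpt _) (hpt _)
  have h1 := ProbabilityMeasure.tendsto_measure_of_null_frontier_of_tendsto'
    (tendsto_empiricalMeasure h) (E := arc a b) hnull
  have h2 := (ENNReal.tendsto_toReal (measure_ne_top volume (arc a b))).comp h1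
  change Filter.Tendsto _ _ (nhds (volume (arc a b)).toReal) at h2
  rw [volume_arc ha hab hb, ENNReal.toReal_ofReal (by linarith)] at h2
  refine h2.congr fun N => ?_
  exact empiricalMeasure_arc v N ha hab hb

/-! ### Hankel determinants and linear recurrences -/

/-- Hadamard's inequality. -/
theorem Matrix.abs_det_le_prod_norm_row {n : ℕ} (A : Matrix (Fin n) (Fin n) ℝ) :
    |A.det| ≤ ∏ i, √(∑ j, A i j ^ 2) := by
  have : Fact (Module.finrank ℝ (EuclideanSpace ℝ (Fin n)) = n) := ⟨by simp⟩
  let b := EuclideanSpace.basisFun (Fin n) ℝ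
  let o := b.toBasis.orientation
  have h := o.abs_volumeForm_apply_le fun i => WithLp.toLp 2 (A i)
  rw [o.volumeForm_robust' b] at h
  have h2 : b.toBasis.det (fun i => WithLp.toLp 2 (A i)) = A.det := by
    rw [Module.Basis.det_apply, ← Matrix.det_transpose]
    congr 1
  rw [h2] at h
  simpa [EuclideanSpace.norm_eq] using h

/-- The Hankel matrix `(a (i + j))` of order `n`. -/
def hankelMatrix {R : Type*} (a : ℕ → R) (n : ℕ) : Matrix (Fin n) (Fin n) R :=
  fun i j => a (i + j)

/-- The linear functional on polynomials with moments `a`. -/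
noncomputable def momentFunctional (a : ℕ → ℚ) : ℚ[X] →ₗ[ℚ] ℚ :=
  Polynomial.lsum fun n => LinearMap.mulRight ℚ (a n)

theorem momentFunctional_apply (a : ℕ → ℚ) (P : ℚ[X]) :
    momentFunctional a P = P.sum fun n c => c * a n := by
  simp [momentFunctional, Polynomial.lsum_apply]

@[simp] theorem momentFunctional_X_pow (a : ℕ → ℚ) (n : ℕ) :
    momentFunctional a (X ^ n) = a n := by
  rw [momentFunctional_apply, ← monomial_one_right_eq_X_pow, sum_monomial_index] <;> simp

theorem momentFunctional_mul_eq_zero {a : ℕ → ℚ} {P : ℚ[X]} {n : ℕ}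
    (h : ∀ i < n, momentFunctional a (P * X ^ i) = 0) {R : ℚ[X]} (hR : R.natDegree < n) :
    momentFunctional a (P * R) = 0 := by
  rw [R.as_sum_range' n hR, Finset.mul_sum, map_sum]
  refine Finset.sum_eq_zero fun i hi => ?_
  rw [← C_mul_X_pow_eq_monomial, mul_left_comm, ← smul_eq_C_mul, map_smul,
    h i (Finset.mem_range.mp hi), smul_zero]

/-- A vanishing Hankel determinant of order `n` means that some nonzero polynomial of degree less
than `n` is orthogonal to all such polynomials. -/
theorem exists_orthogonal_of_det_hankelMatrix_eq_zero {a : ℕ → ℚ} {n : ℕ}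
    (h : (hankelMatrix a n).det = 0) :
    ∃ P : ℚ[X], P ≠ 0 ∧ P.degree < n ∧ ∀ i < n, momentFunctional a (P * X ^ i) = 0 := by
  obtain ⟨v, hv0, hv⟩ := Matrix.exists_mulVec_eq_zero_iff.mpr h
  have hc : ∀ j : Fin n, (∑ k : Fin n, C (v k) * X ^ (k : ℕ)).coeff j = v j := by
    intro j
    rw [finsetSum_coeff, Finset.sum_eq_single j]
    · simp
    · intro k _ hk
      rw [coeff_C_mul_X_pow, if_neg]
      intro h
      exact hk (Fin.ext h.symm)
    · simp
  refine ⟨∑ k : Fin n, C (v k) * X ^ (k : ℕ), fun h0 => hv0 ?_, degree_sum_fin_lt v,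
    fun i hi => ?_⟩
  · funext j
    rw [← hc j, h0]
    simp
  · rw [Finset.sum_mul, map_sum]
    have := congrFun hv ⟨i, hi⟩
    simp only [Matrix.mulVec, dotProduct, hankelMatrix, Pi.zero_apply] at this
    rw [← this]
    refine Finset.sum_congr rfl fun k _ => ?_
    rw [mul_assoc, ← pow_add, ← smul_eq_C_mul, map_smul, momentFunctional_X_pow, smul_eq_mul,
      mul_comm, add_comm]

/-- Kronecker's criterion: if the Hankel determinants vanish from some order on, the sequence
satisfies a linear recurrence. -/
theorem exists_recurrence_of_det_hankelMatrix_eq_zero {a : ℕ → ℚ} {N : ℕ}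
    (h : ∀ n, N ≤ n → (hankelMatrix a n).det = 0) :
    ∃ Q : ℚ[X], Q ≠ 0 ∧ ∀ i, momentFunctional a (Q * X ^ i) = 0 := by
  classical
  let S : ℕ → Prop := fun n =>
    ∃ P : ℚ[X], P ≠ 0 ∧ P.degree < n ∧ ∀ i < n, momentFunctional a (P * X ^ i) = 0
  -- `k + 1` is the least order from which on all truncations of the form are degenerate.
  have hex : ∃ k, ∀ n, k < n → S n :=
    ⟨N, fun n hn => exists_orthogonal_of_det_hankelMatrix_eq_zero (h n hn.le)⟩
  obtain ⟨k, hk, hkS⟩ : ∃ k, (∀ n, k < n → S n) ∧ ¬ S k := by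
    refine ⟨Nat.find hex, Nat.find_spec hex, fun hS => ?_⟩
    rcases Nat.eq_zero_or_pos (Nat.find hex) with h0 | hpos
    · rw [h0] at hS
      obtain ⟨P, hP0, hP, -⟩ := hS
      rw [Nat.cast_zero, ← not_le] at hP
      exact hP (zero_le_degree_iff.mpr hP0)
    · refine Nat.find_min hex (Nat.sub_one_lt hpos.ne') fun n hn => ?_
      rcases (show Nat.find hex = n ∨ Nat.find hex < n by omega) with rfl | hn'
      · exact hS
      · exact Nat.find_spec hex n hn'
  obtain ⟨Q, hQ0, hQdeg, hQ⟩ := hk (k + 1) k.lt_succ_self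
  have hQk : Q.natDegree = k := by
    refine le_antisymm ?_ ?_
    · have := (natDegree_lt_iff_degree_lt hQ0).mpr hQdeg
      omega
    · by_contra! hlt
      exact hkS ⟨Q, hQ0, (natDegree_lt_iff_degree_lt hQ0).mp hlt, fun i hi => hQ i (by omega)⟩
  refine ⟨Q, hQ0, fun i => ?_⟩
  induction i using Nat.strong_induction_on with
  | _ m ih =>
  rcases Nat.lt_or_ge m (k + 1) with hm | hm
  · exact hQ m hm
  obtain ⟨P, hP0, hPdeg, hP⟩ := hk (m + 1) (by omega)
  have hPnat : P.natDegree ≤ m := by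
    have := (natDegree_lt_iff_degree_lt hP0).mpr hPdeg
    omega
  have hdiv : Q * (P / Q) + P % Q = P := EuclideanDomain.div_add_mod P Q
  have hTdeg : (P % Q).degree < k := by
    rw [← hQk, ← degree_eq_natDegree hQ0]
    exact EuclideanDomain.mod_lt P hQ0
  have hSdeg : (P / Q).natDegree ≤ m - k := by
    by_cases hS0 : P / Q = 0
    · simp [hS0]
    have h1 : (Q * (P / Q)).natDegree ≤ m := by
      rw [eq_sub_of_add_eq hdiv]
      refine (natDegree_sub_le _ _).trans (max_le hPnat ?_)
      exact (natDegree_le_iff_degree_le.mpr hTdeg.le).trans (by omega)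
    rw [natDegree_mul hQ0 hS0] at h1
    omega
  -- The remainder is orthogonal to everything of degree less than `k`, hence zero.
  have hT : P % Q = 0 := by
    by_contra hT0
    refine hkS ⟨P % Q, hT0, hTdeg, fun i hi => ?_⟩
    have h1 : P % Q * X ^ i = P * X ^ i - Q * (P / Q * X ^ i) := by
      linear_combination X ^ i * hdiv
    have h2 : momentFunctional a (Q * (P / Q * X ^ i)) = 0 := by
      refine momentFunctional_mul_eq_zero (n := m) ih ?_
      have h3 : (P / Q * X ^ i).natDegree ≤ m - k + i :=
        natDegree_mul_le.trans (by rw [natDegree_X_pow]; omega)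
      omega
    rw [h1, map_sub, hP i (by omega), h2, sub_zero]
  rw [hT, add_zero] at hdiv
  have hS0 : P / Q ≠ 0 := by
    intro h0
    rw [h0, mul_zero] at hdiv
    exact hP0 hdiv.symm
  -- Pair `P = Q * S` with the monomial that lifts `S` to degree `m`.
  set s := (P / Q).natDegree with hs
  have hlead := hP (m - s) (by omega)
  have hsplit : P * X ^ (m - s) =
      (P / Q).leadingCoeff • (Q * X ^ m) + Q * ((P / Q).eraseLead * X ^ (m - s)) := by
    have h1 : (P / Q).eraseLead + C (P / Q).leadingCoeff * X ^ s = P / Q :=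
      eraseLead_add_C_mul_X_pow _
    have h2 : (X : ℚ[X]) ^ m = X ^ s * X ^ (m - s) := by rw [← pow_add]; congr 1; omega
    rw [smul_eq_C_mul, h2]
    linear_combination (-X ^ (m - s)) * hdiv - Q * X ^ (m - s) * h1
  have hlow : momentFunctional a (Q * ((P / Q).eraseLead * X ^ (m - s))) = 0 := by
    by_cases he : (P / Q).eraseLead = 0
    · simp [he]
    refine momentFunctional_mul_eq_zero (n := m) ih ?_
    have h3 : (P / Q).eraseLead.degree < s := by
      rw [hs, ← degree_eq_natDegree hS0]
      exact degree_eraseLead_lt hS0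
    have h4 := (natDegree_lt_iff_degree_lt he).mpr h3
    have h5 : ((P / Q).eraseLead * X ^ (m - s)).natDegree ≤
        (P / Q).eraseLead.natDegree + (m - s) := natDegree_mul_le.trans (by rw [natDegree_X_pow])
    omega
  rw [hsplit, map_add, hlow, add_zero, map_smul, smul_eq_mul] at hlead
  exact (mul_eq_zero.mp hlead).resolve_left (leadingCoeff_ne_zero.mpr hS0)

/-! ### Rounding errors of `x * θ ^ n` -/

/-- The signed distance from `y` to the integer `round y`. -/
noncomputable def roundErr (y : ℝ) : ℝ := y - round y

theorem abs_roundErr (y : ℝ) : |roundErr y| = distNearestInt y := rfl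

theorem roundErr_sq (y : ℝ) : roundErr y ^ 2 = distNearestInt y ^ 2 := by
  rw [← abs_roundErr, sq_abs]

theorem abs_roundErr_le_half (y : ℝ) : |roundErr y| ≤ 1 / 2 := abs_sub_round y

/-- Subtracting `θ` times each row of the Hankel matrix of the rounded values `round (x * θ ^ n)`
from the next leaves only rounding errors outside the first row, and Hadamard's inequality bounds
the determinant by a product whose factors decrease to zero. -/
theorem tendsto_det_hankelMatrix_round {θ x : ℝ} (hθ : 1 < θ)
    (hs : Summable fun n : ℕ => roundErr (x * θ ^ n) ^ 2) :
    Filter.Tendsto (fun n : ℕ => (hankelMatrix (fun k => (round (x * θ ^ k) : ℝ)) (n + 1)).det)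
      Filter.atTop (nhds 0) := by
  set a : ℕ → ℝ := fun k => (round (x * θ ^ k) : ℝ) with ha
  set e : ℕ → ℝ := fun k => roundErr (x * θ ^ k) with he
  have hae : ∀ k, a k = x * θ ^ k - e k := fun k => by simp [ha, he, roundErr]
  set η : ℕ → ℝ := fun k => θ * e k - e (k + 1) with hη
  have hηa : ∀ k, a (k + 1) = η k + θ * a k := by
    intro k
    rw [hae, hae, hη]
    ring
  have hsη : Summable fun k => η k ^ 2 := by
    have h1 : Summable fun k => 2 * (θ ^ 2 * e k ^ 2) + 2 * e (k + 1) ^ 2 :=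
      ((hs.mul_left _).mul_left _).add (((summable_nat_add_iff 1).mpr hs).mul_left _)
    refine h1.of_nonneg_of_le (fun k => sq_nonneg _) fun k => ?_
    rw [hη]
    nlinarith [sq_nonneg (θ * e k + e (k + 1))]
  set T : ℕ → ℝ := fun i => ∑' k, η (k + i) ^ 2 with hT
  have hT0 : ∀ i, 0 ≤ T i := fun i => tsum_nonneg fun k => sq_nonneg _
  have hTlim : Filter.Tendsto T Filter.atTop (nhds 0) := tendsto_sum_nat_add fun k => η k ^ 2
  set C : ℝ := |x| + 1 with hC
  have haC : ∀ k, |a k| ≤ C * θ ^ k := by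
    intro k
    rw [hae]
    have h1 : |x * θ ^ k| = |x| * θ ^ k := by rw [abs_mul, abs_of_pos (by positivity : 0 < θ ^ k)]
    have h2 : 1 ≤ θ ^ k := one_le_pow₀ hθ.le
    have h3 : |e k| ≤ 1 / 2 := abs_roundErr_le_half _
    calc |x * θ ^ k - e k| ≤ |x * θ ^ k| + |e k| := abs_sub _ _
      _ ≤ C * θ ^ k := by rw [h1, hC]; linarith
  set u : ℕ → ℝ := fun n =>
    ((n + 1 : ℕ) : ℝ) * (C * θ ^ n) ^ 2 * ∏ i ∈ Finset.range n, T i with hu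
  have hu0 : ∀ n, 0 ≤ u n := fun n =>
    mul_nonneg (by positivity) (Finset.prod_nonneg fun i _ => hT0 i)
  have hdet : ∀ n, (hankelMatrix a (n + 1)).det ^ 2 ≤ u n := by
    intro n
    let B : Matrix (Fin (n + 1)) (Fin (n + 1)) ℝ :=
      Matrix.of fun i j => Fin.cases (a j) (fun k : Fin n => η (k + j)) i
    have hAB : (hankelMatrix a (n + 1)).det = B.det := by
      refine Matrix.det_eq_of_forall_row_eq_smul_add_pred (fun _ => θ) (fun j => ?_)
        fun i j => ?_
      · simp [B, hankelMatrix]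
      · have h1 := hηa (i + j)
        simp only [B, hankelMatrix, Fin.val_succ, Matrix.of_apply, Fin.cases_succ, Fin.val_castSucc]
        rw [← h1]
        congr 1
        omega
    have h1 := Matrix.abs_det_le_prod_norm_row B
    rw [← sq_abs, hAB]
    refine (pow_le_pow_left₀ (abs_nonneg _) h1 2).trans ?_
    simp only [hu]
    rw [← Finset.prod_pow, Fin.prod_univ_succ, ← Fin.prod_univ_eq_prod_range]
    refine mul_le_mul ?_ ?_ (Finset.prod_nonneg fun i _ => sq_nonneg _) (by positivity)
    · rw [Real.sq_sqrt (Finset.sum_nonneg fun j _ => sq_nonneg _)]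
      refine (Finset.sum_le_card_nsmul _ _ ((C * θ ^ n) ^ 2) fun j _ => ?_).trans ?_
      · simp only [B, Matrix.of_apply, Fin.cases_zero]
        rw [← sq_abs]
        refine pow_le_pow_left₀ (abs_nonneg _) ((haC j).trans ?_) 2
        have hjn : (j : ℕ) ≤ n := Nat.lt_succ_iff.mp j.2
        gcongr
        exact hθ.le
      · simp
    · refine Finset.prod_le_prod (fun i _ => sq_nonneg _) fun i _ => ?_
      rw [Real.sq_sqrt (Finset.sum_nonneg fun j _ => sq_nonneg _)]
      simp only [B, Matrix.of_apply, Fin.cases_succ]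
      rw [Fin.sum_univ_eq_sum_range (fun j => η (i + j) ^ 2)]
      simp_rw [add_comm (i : ℕ)]
      exact ((summable_nat_add_iff (i : ℕ)).mpr hsη).sum_le_tsum _ fun _ _ => sq_nonneg _
  -- Ratio test: `u (n + 1) / u n ≤ 2 * θ ^ 2 * T n`.
  have hulim : Filter.Tendsto u Filter.atTop (nhds 0) := by
    refine Summable.tendsto_atTop_zero ?_
    refine summable_of_ratio_norm_eventually_le (r := 1 / 2) (by norm_num) ?_
    have hev : ∀ᶠ n in Filter.atTop, T n < 1 / (4 * θ ^ 2) :=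
      hTlim.eventually (gt_mem_nhds (by positivity))
    filter_upwards [hev] with n hn
    rw [Real.norm_of_nonneg (hu0 _), Real.norm_of_nonneg (hu0 _)]
    rw [lt_div_iff₀ (by positivity)] at hn
    have h1 : u (n + 1) = ((n + 2 : ℕ) : ℝ) * (θ ^ 2 * T n) *
        ((C * θ ^ n) ^ 2 * ∏ i ∈ Finset.range n, T i) := by
      simp only [hu, Finset.prod_range_succ]
      push_cast
      ring
    have h2 : u n = ((n + 1 : ℕ) : ℝ) * ((C * θ ^ n) ^ 2 * ∏ i ∈ Finset.range n, T i) := by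
      simp only [hu]
      ring
    rw [h1, h2, ← mul_assoc (1 / 2 : ℝ)]
    refine mul_le_mul_of_nonneg_right ?_
      (mul_nonneg (by positivity) (Finset.prod_nonneg fun i _ => hT0 i))
    have h3 : θ ^ 2 * T n ≤ 1 / 4 := by linarith
    have h4 : ((n + 2 : ℕ) : ℝ) ≤ 2 * ((n + 1 : ℕ) : ℝ) := by
      push_cast
      linarith [n.cast_nonneg (α := ℝ)]
    calc ((n + 2 : ℕ) : ℝ) * (θ ^ 2 * T n) ≤ (2 * ((n + 1 : ℕ) : ℝ)) * (1 / 4) := by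
          refine mul_le_mul h4 h3 (mul_nonneg (by positivity) (hT0 n)) (by positivity)
      _ = 1 / 2 * ((n + 1 : ℕ) : ℝ) := by ring
  have hsq := squeeze_zero (fun n => sq_nonneg _) hdet hulim
  have := hsq.sqrt
  simp only [Real.sqrt_sq_eq_abs, Real.sqrt_zero] at this
  exact (tendsto_zero_iff_abs_tendsto_zero _).mpr this

theorem det_hankelMatrix_round_eventually_eq_zero {θ x : ℝ} (hθ : 1 < θ)
    (hs : Summable fun n : ℕ => roundErr (x * θ ^ n) ^ 2) :
    ∃ N, ∀ n, N ≤ n → (hankelMatrix (fun k => (round (x * θ ^ k) : ℚ)) n).det = 0 := by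
  have hcast : ∀ (R : Type) [CommRing R] (n : ℕ),
      (hankelMatrix (fun k => (round (x * θ ^ k) : R)) n).det =
      ((hankelMatrix (fun k => round (x * θ ^ k)) n).det : R) := by
    intro R _ n
    exact ((Int.castRingHom R).map_det _).symm
  have h := tendsto_det_hankelMatrix_round hθ hs
  obtain ⟨N, hN⟩ := (Metric.tendsto_atTop.mp h) 1 one_pos
  refine ⟨N + 1, fun n hn => ?_⟩
  have h1 := hN (n - 1) (by omega)
  rw [Nat.sub_add_cancel (by omega), dist_zero_right, hcast ℝ, Real.norm_eq_abs] at h1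
  have h2 : (hankelMatrix (fun k => round (x * θ ^ k)) n).det = 0 :=
    Int.abs_lt_one_iff.mp (by exact_mod_cast h1)
  rw [hcast ℚ, h2, Int.cast_zero]

/-! ### The action of polynomials on sequences by shifts -/

/-- The action of a polynomial `P` on a sequence `f`, the variable acting by the shift: the `i`-th
term of the result is `∑ j, P.coeff j * f (i + j)`. -/
noncomputable def polyShift {R : Type*} [CommRing R] (P : R[X]) (f : ℕ → R) (i : ℕ) : R :=
  P.sum fun j c => c * f (i + j)

section polyShift

variable {R : Type*} [CommRing R]

theorem polyShift_add_left (P Q : R[X]) (f : ℕ → R) (i : ℕ) :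
    polyShift (P + Q) f i = polyShift P f i + polyShift Q f i :=
  sum_add_index _ _ _ (by simp) fun _ _ _ => by ring

theorem polyShift_monomial (n : ℕ) (c : R) (f : ℕ → R) (i : ℕ) :
    polyShift (monomial n c) f i = c * f (i + n) :=
  sum_monomial_index _ _ (by simp)

theorem polyShift_geometric (P : R[X]) (y t : R) (i : ℕ) :
    polyShift P (fun n => y * t ^ n) i = y * t ^ i * P.eval t := by
  induction P using Polynomial.induction_on' with
  | add P Q hP hQ => rw [polyShift_add_left, hP, hQ, eval_add]; ring
  | monomial n c => rw [polyShift_monomial, eval_monomial]; ring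

theorem polyShift_sub_right (P : R[X]) (f g : ℕ → R) (i : ℕ) :
    polyShift P (fun n => f n - g n) i = polyShift P f i - polyShift P g i := by
  induction P using Polynomial.induction_on' with
  | add P Q hP hQ => rw [polyShift_add_left, polyShift_add_left, polyShift_add_left, hP, hQ]; ring
  | monomial n c => rw [polyShift_monomial, polyShift_monomial, polyShift_monomial]; ring

theorem polyShift_X_sub_C_mul (t : R) (M : R[X]) (f : ℕ → R) (i : ℕ) :
    polyShift ((X - C t) * M) f i = polyShift M f (i + 1) - t * polyShift M f i := by
  induction M using Polynomial.induction_on' with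
  | add P Q hP hQ =>
    rw [mul_add, polyShift_add_left, polyShift_add_left, polyShift_add_left, hP, hQ]; ring
  | monomial n c =>
    have h : (X - C t) * monomial n c = monomial (n + 1) c + monomial n (-(t * c)) := by
      rw [sub_mul, X_mul_monomial, C_mul_monomial, map_neg, sub_eq_add_neg]
    rw [h, polyShift_add_left, polyShift_monomial, polyShift_monomial, polyShift_monomial,
      polyShift_monomial, add_right_comm i 1 n, ← add_assoc]
    ring

theorem polyShift_C_mul (c : R) (M : R[X]) (f : ℕ → R) (i : ℕ) :
    polyShift (C c * M) f i = c * polyShift M f i := by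
  induction M using Polynomial.induction_on' with
  | add P Q hP hQ => rw [mul_add, polyShift_add_left, polyShift_add_left, hP, hQ, mul_add]
  | monomial n d => rw [C_mul_monomial, polyShift_monomial, polyShift_monomial, mul_assoc]

theorem polyShift_map {S : Type*} [CommRing S] (σ : R →+* S) (P : R[X]) (f : ℕ → R) (i : ℕ) :
    polyShift (P.map σ) (fun n => σ (f n)) i = σ (polyShift P f i) := by
  induction P using Polynomial.induction_on' with
  | add P Q hP hQ =>
    rw [Polynomial.map_add, polyShift_add_left, polyShift_add_left, hP, hQ, map_add]
  | monomial n c => rw [map_monomial, polyShift_monomial, polyShift_monomial, map_mul]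

end polyShift

theorem momentFunctional_mul_X_pow (a : ℕ → ℚ) (P : ℚ[X]) (i : ℕ) :
    momentFunctional a (P * X ^ i) = polyShift P a i := by
  induction P using Polynomial.induction_on' with
  | add P Q hP hQ => rw [add_mul, map_add, hP, hQ, polyShift_add_left]
  | monomial n c =>
    rw [monomial_mul_X_pow, polyShift_monomial, ← C_mul_X_pow_eq_monomial, ← smul_eq_C_mul,
      map_smul, momentFunctional_X_pow, smul_eq_mul, add_comm]

theorem tendsto_polyShift_zero {F : Type*} [NormedField F] (P : F[X]) {f : ℕ → F}
    (hf : Filter.Tendsto f Filter.atTop (nhds 0)) :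
    Filter.Tendsto (polyShift P f) Filter.atTop (nhds 0) := by
  have h : (0 : F) = ∑ j ∈ P.support, P.coeff j * 0 := by simp
  rw [h]
  exact tendsto_finsetSum _ fun j _ =>
    ((Filter.tendsto_add_atTop_iff_nat j).mpr hf).const_mul _

/-! ### Pisot's theorem -/

/-- A multiple of a geometric progression of ratio at least one in modulus tends to zero only if it
vanishes. -/
theorem eq_zero_of_tendsto_mul_pow {F : Type*} [NormedField F] {c t : F} (ht : 1 ≤ ‖t‖)
    (h : Filter.Tendsto (fun i : ℕ => c * t ^ i) Filter.atTop (nhds 0)) : c = 0 := by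
  rw [← norm_eq_zero]
  have h1 := h.norm
  rw [norm_zero] at h1
  refine le_antisymm (ge_of_tendsto' h1 fun i => ?_) (norm_nonneg c)
  rw [norm_mul, norm_pow]
  exact le_mul_of_one_le_right (norm_nonneg c) (one_le_pow₀ ht)

section Pisot

variable {θ x : ℝ}

theorem tendsto_roundErr (hs : Summable fun n : ℕ => roundErr (x * θ ^ n) ^ 2) :
    Filter.Tendsto (fun n : ℕ => roundErr (x * θ ^ n)) Filter.atTop (nhds 0) := by
  have := hs.tendsto_atTop_zero.sqrt
  simp only [Real.sqrt_sq_eq_abs, Real.sqrt_zero] at this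
  exact (tendsto_zero_iff_abs_tendsto_zero _).mpr this

/-- `P` acts on the rounded values as on the difference of a geometric progression and the rounding
errors. -/
theorem polyShift_round (P : ℂ[X]) (i : ℕ) :
    polyShift P (fun n => (round (x * θ ^ n) : ℂ)) i =
      x * (θ : ℂ) ^ i * P.eval (θ : ℂ) -
        polyShift P (fun n => (roundErr (x * θ ^ n) : ℂ)) i := by
  rw [← polyShift_geometric, ← polyShift_sub_right]
  congr 1
  funext n
  simp [roundErr]

theorem isAlgebraic_of_summable (hθ : 1 < θ) (hx : x ≠ 0)
    (hs : Summable fun n : ℕ => roundErr (x * θ ^ n) ^ 2) : IsAlgebraic ℚ θ := by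
  obtain ⟨N, hN⟩ := det_hankelMatrix_round_eventually_eq_zero hθ hs
  obtain ⟨Q, hQ0, hQ⟩ := exists_recurrence_of_det_hankelMatrix_eq_zero hN
  refine ⟨Q, hQ0, ?_⟩
  simp_rw [momentFunctional_mul_X_pow] at hQ
  have he : Filter.Tendsto (fun n : ℕ => (roundErr (x * θ ^ n) : ℂ)) Filter.atTop (nhds 0) :=
    (Complex.continuous_ofReal.tendsto 0).comp (tendsto_roundErr hs)
  have h1 : ∀ i, x * (Q.map (algebraMap ℚ ℂ)).eval (θ : ℂ) * (θ : ℂ) ^ i =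
      polyShift (Q.map (algebraMap ℚ ℂ)) (fun n => (roundErr (x * θ ^ n) : ℂ)) i := by
    intro i
    have h2 := polyShift_map (algebraMap ℚ ℂ) Q (fun n => (round (x * θ ^ n) : ℚ)) i
    simp only [map_intCast] at h2
    rw [hQ, map_zero, polyShift_round] at h2
    linear_combination h2
  have h3 := eq_zero_of_tendsto_mul_pow (t := (θ : ℂ))
    (by rw [Complex.norm_real, Real.norm_of_nonneg (by linarith)]; exact hθ.le)
    ((tendsto_polyShift_zero _ he).congr fun i => (h1 i).symm)
  have h4 := (mul_eq_zero.mp h3).resolve_left (Complex.ofReal_ne_zero.mpr hx)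
  rw [eval_map_algebraMap] at h4
  have h5 : aeval ((algebraMap ℝ ℂ) θ) Q = 0 := h4
  rw [aeval_algebraMap_apply] at h5
  exact Complex.ofReal_injective (by simpa using h5)

/-- Once `θ` is known to be algebraic, the rounded values eventually satisfy the recurrence given
by the minimal polynomial: its defect tends to zero and takes values in `(1 / D) ℤ` for a fixed
common denominator `D`. -/
theorem exists_polyShift_minpoly_eq_zero
    (hs : Summable fun n : ℕ => roundErr (x * θ ^ n) ^ 2) :
    ∃ s, ∀ i, s ≤ i →
      polyShift (minpoly ℚ θ) (fun n => (round (x * θ ^ n) : ℚ)) i = 0 := by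
  set μ := minpoly ℚ θ with hμ
  obtain ⟨D, hD, hDP⟩ := IsLocalization.integerNormalization_spec (nonZeroDivisors ℤ) μ
  set P := IsLocalization.integerNormalization (nonZeroDivisors ℤ) μ with hP
  have hD0 : (D : ℚ) ≠ 0 := by exact_mod_cast nonZeroDivisors.ne_zero hD
  have hPμ : P.map (Int.castRingHom ℚ) = C (D : ℚ) * μ := by
    rw [← smul_eq_C_mul, Int.cast_smul_eq_zsmul, ← hDP]
    rfl
  have hcast : ∀ i, ((polyShift P (fun n => round (x * θ ^ n)) i : ℤ) : ℚ) =
      D * polyShift μ (fun n => (round (x * θ ^ n) : ℚ)) i := by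
    intro i
    have h := polyShift_map (Int.castRingHom ℚ) P (fun n => round (x * θ ^ n)) i
    rw [hPμ, polyShift_C_mul] at h
    exact h.symm
  have he : Filter.Tendsto (fun n : ℕ => (roundErr (x * θ ^ n) : ℂ)) Filter.atTop (nhds 0) :=
    (Complex.continuous_ofReal.tendsto 0).comp (tendsto_roundErr hs)
  have hroot : (P.map (Int.castRingHom ℂ)).eval (θ : ℂ) = 0 := by
    have h1 : P.map (Int.castRingHom ℂ) = (C (D : ℚ) * μ).map (algebraMap ℚ ℂ) := by
      rw [← hPμ, Polynomial.map_map]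
      congr 1
    have h2 : aeval ((algebraMap ℝ ℂ) θ) μ = 0 := by
      rw [aeval_algebraMap_apply, hμ, minpoly.aeval, map_zero]
    rw [h1, Polynomial.map_mul, eval_mul, eval_map_algebraMap μ]
    exact mul_eq_zero_of_right _ h2
  have hlim : Filter.Tendsto
      (fun i => ((polyShift P (fun n => round (x * θ ^ n)) i : ℤ) : ℂ)) Filter.atTop (nhds 0) := by
    have h1 := (tendsto_polyShift_zero (P.map (Int.castRingHom ℂ)) he).neg
    rw [neg_zero] at h1
    refine h1.congr fun i => ?_
    have h2 := polyShift_map (Int.castRingHom ℂ) P (fun n => round (x * θ ^ n)) i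
    simp only [eq_intCast] at h2
    rw [← h2, polyShift_round, hroot]
    ring
  obtain ⟨s, hs'⟩ := (Metric.tendsto_atTop.mp hlim) 1 one_pos
  refine ⟨s, fun i hi => ?_⟩
  have h1 := hs' i hi
  rw [dist_zero_right, Complex.norm_intCast] at h1
  have h2 : polyShift P (fun n => round (x * θ ^ n)) i = 0 :=
    Int.abs_lt_one_iff.mp (by exact_mod_cast h1)
  have h3 := hcast i
  rw [h2, Int.cast_zero] at h3
  exact (mul_eq_zero.mp h3.symm).resolve_left hD0

/-- Pisot's theorem: if the distances of `x * θ ^ n` to the integers are square-summable, then `θ`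
is a Pisot number and `x` lies in `ℚ(θ)`.

With `μ` the minimal polynomial of `θ` and `M = μ / (X - θ)` over `ℚ(θ)`, the sequence `b` obtained
by letting `M` act on the rounded values is eventually geometric of ratio `θ`. Its images under the
embeddings of `ℚ(θ)` locate `x` and the conjugates of `θ`, and its terms lie in the finitely
generated group spanned by the coefficients of `M`, so `θ` is integral. -/
theorem isPisotNumber_and_mem_adjoin_of_summable (hθ : 1 < θ) (hx : x ≠ 0)
    (hs : Summable fun n : ℕ => roundErr (x * θ ^ n) ^ 2) :
    IsPisotNumber θ ∧ x ∈ ℚ⟮θ⟯ := by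
  have halg : IsIntegral ℚ θ := (isAlgebraic_of_summable hθ hx hs).isIntegral
  obtain ⟨s, hrec⟩ := exists_polyShift_minpoly_eq_zero hs
  set μ := minpoly ℚ θ with hμ
  set t : ℚ⟮θ⟯ := AdjoinSimple.gen ℚ θ with ht
  have htθ : algebraMap ℚ⟮θ⟯ ℝ t = θ := AdjoinSimple.algebraMap_gen ℚ θ
  have hμt : aeval t μ = 0 := aeval_gen_minpoly ℚ θ
  set μK := μ.map (algebraMap ℚ ℚ⟮θ⟯) with hμK
  have hroot : μK.IsRoot t := by rw [IsRoot, hμK, eval_map_algebraMap, hμt]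
  set M := μK /ₘ (X - C t) with hM
  have hXM : (X - C t) * M = μK := mul_divByMonic_eq_iff_isRoot.mpr hroot
  have hMt : M.eval t ≠ 0 := by
    have hsep : μK.Separable := (minpoly.irreducible halg).separable.map
    have hd := hsep.eval₂_derivative_ne_zero (RingHom.id _) (x := t)
      (by rwa [eval₂_id])
    rw [← hXM] at hd
    simpa using hd
  set b : ℕ → ℚ⟮θ⟯ := polyShift M fun n => (round (x * θ ^ n) : ℚ⟮θ⟯) with hb
  have hbstep : ∀ i, s ≤ i → b (i + 1) = t * b i := by
    intro i hi
    have h1 := polyShift_map (algebraMap ℚ ℚ⟮θ⟯) μ (fun n => (round (x * θ ^ n) : ℚ)) i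
    rw [hrec i hi, map_zero, ← hμK, ← hXM, polyShift_X_sub_C_mul] at h1
    simp only [map_intCast] at h1
    exact sub_eq_zero.mp h1
  have hbpow : ∀ i, b (s + i) = t ^ i * b s := by
    intro i
    induction i with
    | zero => simp
    | succ i ih => rw [← add_assoc, hbstep _ (Nat.le_add_right s i), ih]; ring
  have he : Filter.Tendsto (fun n : ℕ => (roundErr (x * θ ^ n) : ℂ)) Filter.atTop (nhds 0) :=
    (Complex.continuous_ofReal.tendsto 0).comp (tendsto_roundErr hs)
  have hσ : ∀ (σ : ℚ⟮θ⟯ →+* ℂ) (i : ℕ), σ (b i) = x * (θ : ℂ) ^ i * (M.map σ).eval (θ : ℂ) -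
      polyShift (M.map σ) (fun n => (roundErr (x * θ ^ n) : ℂ)) i := by
    intro σ i
    rw [← polyShift_round, hb, ← polyShift_map]
    simp only [map_intCast]
  -- The identity embedding shows that `b s = x * θ ^ s * M(θ)`.
  have hbs : ((algebraMap ℚ⟮θ⟯ ℝ (b s) : ℝ)) = x * θ ^ s * algebraMap ℚ⟮θ⟯ ℝ (M.eval t) := by
    set σ : ℚ⟮θ⟯ →+* ℂ := (algebraMap ℝ ℂ).comp (algebraMap ℚ⟮θ⟯ ℝ) with hσdef
    have hσt : σ t = θ := by rw [hσdef, RingHom.comp_apply, htθ]; rfl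
    have hev : (M.map σ).eval (θ : ℂ) = σ (M.eval t) := by rw [← hσt, eval_map_apply]
    have h1 : ∀ i, (σ (b s) - x * (θ : ℂ) ^ s * σ (M.eval t)) * (θ : ℂ) ^ i =
        -polyShift (M.map σ) (fun n => (roundErr (x * θ ^ n) : ℂ)) (i + s) := by
      intro i
      have h2 := hσ σ (s + i)
      rw [hbpow, map_mul, map_pow, hσt, hev, add_comm s i] at h2
      rw [pow_add] at h2
      linear_combination h2
    have hlim := ((Filter.tendsto_add_atTop_iff_nat s).mpr
      (tendsto_polyShift_zero (M.map σ) he)).neg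
    rw [neg_zero] at hlim
    have h3 := eq_zero_of_tendsto_mul_pow (t := (θ : ℂ))
      (by rw [Complex.norm_real, Real.norm_of_nonneg (by linarith)]; exact hθ.le)
      (hlim.congr fun i => (h1 i).symm)
    refine Complex.ofReal_injective ?_
    push_cast
    exact sub_eq_zero.mp h3
  have hMt' : algebraMap ℚ⟮θ⟯ ℝ (M.eval t) ≠ 0 := by simpa using hMt
  have hθ0 : θ ≠ 0 := by positivity
  have hbs0 : b s ≠ 0 := by
    intro h0
    rw [h0, map_zero] at hbs
    exact mul_ne_zero (mul_ne_zero hx (pow_ne_zero s hθ0)) hMt' hbs.symm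
  refine ⟨⟨hθ, ?_, ?_⟩, ?_⟩
  · let N : Submodule ℤ ℚ⟮θ⟯ := Submodule.span ℤ ((fun j => M.coeff j) '' M.support)
    have hNfg : N.FG := Submodule.fg_span ((Finset.finite_toSet _).image _)
    have hbN : ∀ i, b i ∈ N := by
      intro i
      refine Submodule.sum_mem _ fun j hj => ?_
      change M.coeff j * (round (x * θ ^ (i + j)) : ℚ⟮θ⟯) ∈ N
      rw [mul_comm, ← zsmul_eq_mul]
      exact N.smul_mem _ (Submodule.subset_span ⟨j, hj, rfl⟩)
    let N' : Submodule ℤ ℚ⟮θ⟯ := Submodule.span ℤ (Set.range fun i => b (s + i))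
    have hN'N : N' ≤ N := Submodule.span_le.mpr (by rintro _ ⟨i, rfl⟩; exact hbN _)
    have hbs' : b s ∈ N' := Submodule.subset_span ⟨0, rfl⟩
    have hint : IsIntegral ℤ t := by
      refine isIntegral_of_smul_mem_submodule N' (fun h => hbs0 ?_) (hNfg.of_le hN'N) t ?_
      · rw [h] at hbs'
        exact (Submodule.mem_bot ℤ).mp hbs'
      · intro n hn
        induction hn using Submodule.span_induction with
        | mem y hy =>
          obtain ⟨i, rfl⟩ := hy
          refine Submodule.subset_span ⟨i + 1, ?_⟩
          simp only [smul_eq_mul]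
          rw [← add_assoc, hbstep _ (Nat.le_add_right s i)]
        | zero => rw [smul_zero]; exact N'.zero_mem
        | add y z _ _ hy hz => rw [smul_add]; exact N'.add_mem hy hz
        | smul c y _ hy => rw [smul_comm]; exact N'.smul_mem c hy
    rw [← htθ]
    exact hint.algebraMap
  · intro z hz hzθ
    have hz' : aeval z (minpoly ℚ (adjoin.powerBasis halg).gen) = 0 := by
      have hgen : minpoly ℚ (AdjoinSimple.gen ℚ θ) = minpoly ℚ θ := minpoly_gen ℚ θ
      rw [adjoin.powerBasis_gen, hgen]
      exact hz
    let σ : ℚ⟮θ⟯ →ₐ[ℚ] ℂ := (adjoin.powerBasis halg).lift z hz'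
    have hσt : σ t = z := by
      rw [ht, ← adjoin.powerBasis_gen halg]
      exact (adjoin.powerBasis halg).lift_gen z hz'
    have hev : (M.map (σ : ℚ⟮θ⟯ →+* ℂ)).eval (θ : ℂ) = 0 := by
      have h1 : (μK.map (σ : ℚ⟮θ⟯ →+* ℂ)).eval (θ : ℂ) = 0 := by
        have h2 : aeval ((algebraMap ℝ ℂ) θ) μ = 0 := by
          rw [aeval_algebraMap_apply, hμ, minpoly.aeval, map_zero]
        have h3 : μK.map (σ : ℚ⟮θ⟯ →+* ℂ) = μ.map (algebraMap ℚ ℂ) := by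
          rw [hμK, Polynomial.map_map]
          congr 1
          exact σ.comp_algebraMap
        rw [h3, eval_map_algebraMap]
        exact h2
      rw [← hXM, Polynomial.map_mul, eval_mul] at h1
      refine (mul_eq_zero.mp h1).resolve_left ?_
      simp only [Polynomial.map_sub, map_X, map_C, eval_sub, eval_X, eval_C]
      rw [RingHom.coe_coe, hσt]
      exact sub_ne_zero.mpr (Ne.symm hzθ)
    by_contra! hz1
    have h1 : ∀ i, σ (b s) * z ^ i = -polyShift (M.map (σ : ℚ⟮θ⟯ →+* ℂ))
        (fun n => (roundErr (x * θ ^ n) : ℂ)) (i + s) := by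
      intro i
      have h2 := hσ (σ : ℚ⟮θ⟯ →+* ℂ) (s + i)
      rw [hbpow, hev, RingHom.coe_coe, map_mul, map_pow, hσt, add_comm s i] at h2
      linear_combination h2
    have hlim := ((Filter.tendsto_add_atTop_iff_nat s).mpr
      (tendsto_polyShift_zero (M.map (σ : ℚ⟮θ⟯ →+* ℂ)) he)).neg
    rw [neg_zero] at hlim
    have h3 := eq_zero_of_tendsto_mul_pow hz1 (hlim.congr fun i => (h1 i).symm)
    exact hbs0 (by simpa using h3)
  · have hxeq : x = algebraMap ℚ⟮θ⟯ ℝ (b s / (t ^ s * M.eval t)) := by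
      rw [map_div₀, map_mul, map_pow, htθ, hbs]
      field_simp
    rw [hxeq]
    exact (b s / (t ^ s * M.eval t)).2

end Pisot

/-! ### Integral elements of `ℚ(θ)` for a Pisot number `θ` -/

/-- For integral `y` in `ℚ(θ)` the trace of `y * θ ^ q` is an integer that differs from `y * θ ^ q`
by a combination of `q`-th powers of the other conjugates of `θ`. -/
theorem IsPisotNumber.summable_distNearestInt_sq {θ y : ℝ} (hθ : IsPisotNumber θ)
    (hy : y ∈ ℚ⟮θ⟯) (hyint : IsIntegral ℤ y) :
    Summable fun q : ℕ => distNearestInt (y * θ ^ q) ^ 2 := by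
  classical
  obtain ⟨-, hint, hconj⟩ := hθ
  have halg : IsIntegral ℚ θ := hint.tower_top
  have : FiniteDimensional ℚ ℚ⟮θ⟯ := adjoin.finiteDimensional halg
  set t : ℚ⟮θ⟯ := AdjoinSimple.gen ℚ θ with ht
  have htθ : algebraMap ℚ⟮θ⟯ ℝ t = θ := AdjoinSimple.algebraMap_gen ℚ θ
  set w : ℚ⟮θ⟯ := ⟨y, hy⟩ with hw
  have hwy : algebraMap ℚ⟮θ⟯ ℝ w = y := rfl
  have hinj : Function.Injective (algebraMap ℚ⟮θ⟯ ℝ) := (algebraMap ℚ⟮θ⟯ ℝ).injective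
  have htint : IsIntegral ℤ t := (isIntegral_algebraMap_iff hinj).mp (by rwa [htθ])
  have hwint : IsIntegral ℤ w := (isIntegral_algebraMap_iff hinj).mp (by rwa [hwy])
  let σ₀ : ℚ⟮θ⟯ →ₐ[ℚ] ℂ := (Complex.ofRealAm.restrictScalars ℚ).comp (val ℚ⟮θ⟯)
  have hσ₀w : σ₀ w = y := rfl
  have hσ₀t : σ₀ t = θ := congrArg Complex.ofReal htθ
  have hlt : ∀ σ : ℚ⟮θ⟯ →ₐ[ℚ] ℂ, σ ≠ σ₀ → ‖σ t‖ < 1 := by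
    intro σ hσ
    refine hconj _ ?_ fun h => hσ ?_
    · have hμt : aeval t (minpoly ℚ θ) = 0 := aeval_gen_minpoly ℚ θ
      rw [aeval_algHom_apply, hμt, map_zero]
    · refine (adjoin.powerBasis halg).algHom_ext ?_
      rw [adjoin.powerBasis_gen]
      exact h.trans hσ₀t.symm
  have hbound : ∀ q : ℕ, distNearestInt (y * θ ^ q) ≤
      ∑ σ ∈ Finset.univ.erase σ₀, ‖σ w‖ * ‖σ t‖ ^ q := by
    intro q
    obtain ⟨m, hm⟩ := IsIntegrallyClosed.isIntegral_iff.mp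
      (Algebra.isIntegral_trace (L := ℚ) (hwint.mul (htint.pow q)))
    have h1 := trace_eq_sum_embeddings ℂ (K := ℚ) (x := w * t ^ q)
    rw [← hm, ← Finset.add_sum_erase _ _ (Finset.mem_univ σ₀), map_mul, map_pow, hσ₀w, hσ₀t] at h1
    have h2 : ((y * θ ^ q - m : ℝ) : ℂ) =
        -∑ σ ∈ Finset.univ.erase σ₀, σ (w * t ^ q) := by
      have h3 : algebraMap ℚ ℂ (algebraMap ℤ ℚ m) = (m : ℂ) := by simp
      rw [h3] at h1
      push_cast
      linear_combination -h1
    refine (distNearestInt_le_abs_sub _ m).trans ?_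
    rw [← Real.norm_eq_abs, ← Complex.norm_real, h2, norm_neg]
    refine (norm_sum_le _ _).trans_eq (Finset.sum_congr rfl fun σ _ => ?_)
    rw [map_mul, map_pow, norm_mul, norm_pow]
  have hsum : Summable fun q : ℕ => ∑ σ ∈ Finset.univ.erase σ₀, ‖σ w‖ * ‖σ t‖ ^ q :=
    summable_sum fun σ hσ => (summable_geometric_of_lt_one (norm_nonneg _)
      (hlt σ (Finset.ne_of_mem_erase hσ))).mul_left _
  refine hsum.of_nonneg_of_le (fun q => sq_nonneg _) fun q => (hbound q).trans' ?_
  have h1 : distNearestInt (y * θ ^ q) ≤ 1 / 2 := abs_sub_round _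
  nlinarith [distNearestInt_nonneg (y * θ ^ q)]

theorem not_isIntegral_half_add_intCast (m : ℤ) : ¬ IsIntegral ℤ (1 / 2 + (m : ℝ)) := by
  intro h
  have h1 : algebraMap ℚ ℝ (1 / 2 + m) = 1 / 2 + (m : ℝ) := by simp
  rw [← h1, isIntegral_algebraMap_iff (algebraMap ℚ ℝ).injective] at h
  obtain ⟨k, hk⟩ := IsIntegrallyClosed.isIntegral_iff.mp h
  have hk' : (k : ℚ) = 1 / 2 + m := hk
  have h2 : 2 * k = 1 + 2 * m := by
    have : (2 * k : ℚ) = 1 + 2 * m := by rw [hk']; ring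
    exact_mod_cast this
  omega

theorem exists_pos_natCast_mul_isIntegral {x : ℝ} (hx : IsAlgebraic ℚ x) :
    ∃ l : ℕ, 1 ≤ l ∧ IsIntegral ℤ ((l : ℝ) * x) := by
  obtain ⟨d, hd0, hd⟩ := IsAlgebraic.exists_integral_multiple
    ((IsFractionRing.isAlgebraic_iff ℤ ℚ ℝ).mpr hx)
  refine ⟨d.natAbs, Nat.one_le_iff_ne_zero.mpr (Int.natAbs_ne_zero.mpr hd0), ?_⟩
  rw [zsmul_eq_mul] at hd
  rw [Nat.cast_natAbs, Int.cast_abs]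
  rcases abs_choice (d : ℝ) with h | h
  · rwa [h]
  · rw [h, neg_mul]
    exact hd.neg

/-! ### Uniform distribution of digit sums -/

/-- By Weyl's criterion, and since dyadic blocks control all exponential sums of `digitSum`,
uniform distribution amounts to the vanishing of an infinite product of cosines for each
frequency. -/
theorem uniformlyDistributedModOne_digitSum_iff (lam : ℕ → ℝ) :
    UniformlyDistributedModOne (fun j : ℕ => digitSum lam j) ↔
      ∀ l : ℕ, 1 ≤ l →
        (∑' q : ℕ, ENNReal.ofReal (distNearestInt ((l : ℝ) * lam q) ^ 2) = ⊤ ∨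
          ∃ q : ℕ, ∃ m : ℤ, (l : ℝ) * lam q = 1 / 2 + (m : ℝ)) := by
  rw [uniformlyDistributedModOne_iff]
  refine forall₂_congr fun l _ => ?_
  simp_rw [mul_digitSum]
  rw [tendsto_sum_unitExp_digitSum_iff, tendsto_prod_abs_cos_iff]

theorem summable_roundErr_sq_of_tsum_ne_top {f : ℕ → ℝ}
    (h : ∑' q : ℕ, ENNReal.ofReal (distNearestInt (f q) ^ 2) ≠ ⊤) :
    Summable fun q => roundErr (f q) ^ 2 := by
  have := ENNReal.summable_toReal h
  simpa [ENNReal.toReal_ofReal, sq_nonneg, roundErr_sq] using this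

theorem uniformlyDistributedModOne_mul_digitSum_pow_iff {θ : ℝ} (x : ℝ) (hθ : 1 < θ) :
    UniformlyDistributedModOne (fun k : ℕ => x * digitSum (fun q : ℕ => θ ^ q) k) ↔
      (¬ IsPisotNumber θ ∧ x ≠ 0) ∨
        (IsPisotNumber θ ∧ x ∉ IntermediateField.adjoin ℚ ({θ} : Set ℝ)) := by
  simp_rw [mul_digitSum]
  rw [uniformlyDistributedModOne_digitSum_iff]
  constructor
  · intro h
    have hx0 : x ≠ 0 := by
      rintro rfl
      rcases h 1 le_rfl with h | ⟨q, m, h⟩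
      · simp [distNearestInt] at h
      · rw [zero_mul, mul_zero] at h
        refine not_isIntegral_half_add_intCast m ?_
        rw [← h]
        exact isIntegral_zero
    by_cases hP : IsPisotNumber θ
    · refine Or.inr ⟨hP, fun hx => ?_⟩
      have hθalg : IsIntegral ℚ θ := hP.2.1.tower_top
      have := IntermediateField.adjoin.finiteDimensional hθalg
      have hxalg : IsAlgebraic ℚ x :=
        (Algebra.IsIntegral.isIntegral (R := ℚ)
          (⟨x, hx⟩ : IntermediateField.adjoin ℚ ({θ} : Set ℝ))).algebraMap (B := ℝ)
          |>.isAlgebraic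
      obtain ⟨l, hl, hint⟩ := exists_pos_natCast_mul_isIntegral hxalg
      -- A frequency `l` with `l * x` integral violates both alternatives.
      rcases h l hl with h | ⟨q, m, h⟩
      · have hs := hP.summable_distNearestInt_sq (mul_mem (_root_.natCast_mem _ l) hx) hint
        simp_rw [← mul_assoc] at h
        rw [← ENNReal.ofReal_tsum_of_nonneg (fun q => sq_nonneg _) hs] at h
        exact ENNReal.ofReal_ne_top h
      · refine not_isIntegral_half_add_intCast m ?_
        rw [← h, ← mul_assoc]
        exact hint.mul (hP.2.1.pow q)
    · exact Or.inl ⟨hP, hx0⟩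
  · intro h l hl
    refine Or.inl ?_
    by_contra hsum
    have hl0 : (l : ℝ) ≠ 0 := by
      have : 0 < l := hl
      positivity
    have hx0 : x ≠ 0 := by
      rcases h with ⟨-, h⟩ | ⟨-, h⟩
      · exact h
      · rintro rfl
        exact h (zero_mem _)
    have hs := summable_roundErr_sq_of_tsum_ne_top hsum
    simp_rw [← mul_assoc] at hs
    obtain ⟨hP, hmem⟩ :=
      isPisotNumber_and_mem_adjoin_of_summable hθ (mul_ne_zero hl0 hx0) hs
    rcases h with ⟨h, -⟩ | ⟨-, h⟩
    · exact h hP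
    · refine h ?_
      have := div_mem hmem (_root_.natCast_mem (IntermediateField.adjoin ℚ ({θ} : Set ℝ)) l)
      rwa [mul_div_cancel_left₀ _ hl0] at this

theorem UniformlyDistributedModOne.denseModOne_range {v : ℕ → ℝ}
    (hv : UniformlyDistributedModOne v) : DenseModOne (Set.range v) := by
  rw [DenseModOne, dense_iff_inter_open]
  rintro U hU ⟨t, ht⟩
  obtain ⟨y, rfl⟩ := QuotientAddGroup.mk_surjective t
  have ht' : ((Int.fract y : ℝ) : UnitAddCircle) ∈ U := by rw [unitAddCircle_coe_fract]; exact ht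
  have hopen : IsOpen ((fun z : ℝ => (z : UnitAddCircle)) ⁻¹' U) :=
    hU.preimage (AddCircle.continuous_mk' 1)
  obtain ⟨ε, hε, hball⟩ := Metric.isOpen_iff.mp hopen _ ht'
  set a := Int.fract y with ha
  set b := min (a + ε) 1 with hb
  have hab : a < b := lt_min (by linarith) (Int.fract_lt_one y)
  have hlim := hv a b (Int.fract_nonneg y) hab (min_le_right _ _)
  obtain ⟨N, hN⟩ := (hlim.eventually (lt_mem_nhds (sub_pos.mpr hab))).exists
  have hne : Nonempty {j : ℕ // j < N ∧ Int.fract (v j) ∈ Set.Ico a b} := by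
    by_contra hem
    rw [not_nonempty_iff] at hem
    rw [Nat.card_of_isEmpty, Nat.cast_zero, zero_div] at hN
    exact lt_irrefl _ hN
  obtain ⟨j, -, hj1, hj2⟩ := hne
  refine ⟨v j, ?_, v j, ⟨j, rfl⟩, rfl⟩
  rw [← unitAddCircle_coe_fract]
  refine hball ?_
  rw [Metric.mem_ball, Real.dist_eq, abs_of_nonneg (by linarith)]
  linarith [min_le_left (a + ε) 1]

theorem digitSum_eq_sum_finset (lam : ℕ → ℝ) (j : ℕ) :
    ∃ s : Finset ℕ, digitSum lam j = ∑ n ∈ s, lam n := by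
  refine ⟨(Finset.range j.size).filter fun q => binDigit q j = 1, ?_⟩
  rw [digitSum, Finset.sum_filter]
  refine Finset.sum_congr rfl fun q _ => ?_
  rcases binDigit_eq_zero_or_one q j with h | h <;> simp [h]

theorem mainTheorem7 :
    (∀ lam : ℕ → ℝ,
      UniformlyDistributedModOne (fun j : ℕ => digitSum lam j) ↔
        ∀ l : ℕ, 1 ≤ l →
          (∑' q : ℕ, ENNReal.ofReal (distNearestInt ((l : ℝ) * lam q) ^ 2) = ⊤ ∨
            ∃ q : ℕ, ∃ m : ℤ, (l : ℝ) * lam q = 1 / 2 + (m : ℝ))) ∧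
    (∀ θ x : ℝ, 1 < θ →
      (UniformlyDistributedModOne (fun k : ℕ => x * digitSum (fun q : ℕ => θ ^ q) k) ↔
        (¬ IsPisotNumber θ ∧ x ≠ 0) ∨
          (IsPisotNumber θ ∧ x ∉ IntermediateField.adjoin ℚ ({θ} : Set ℝ)))) ∧
    (∀ θ x : ℝ, 1 < θ →
      ((¬ IsPisotNumber θ ∧ x ≠ 0) ∨
          (IsPisotNumber θ ∧ x ∉ IntermediateField.adjoin ℚ ({θ} : Set ℝ))) →
        DenseModOne {y : ℝ | ∃ s : Finset ℕ, y = x * ∑ n ∈ s, θ ^ n}) := by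
  refine ⟨uniformlyDistributedModOne_digitSum_iff,
    fun θ x hθ => uniformlyDistributedModOne_mul_digitSum_pow_iff x hθ, fun θ x hθ h => ?_⟩
  have hud := (uniformlyDistributedModOne_mul_digitSum_pow_iff x hθ).mpr h
  refine hud.denseModOne_range.mono (Set.image_mono ?_)
  rintro _ ⟨k, rfl⟩
  obtain ⟨s, hs⟩ := digitSum_eq_sum_finset (fun q => θ ^ q) k
  exact ⟨s, by simp only [hs]⟩
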